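/- All algebras are unital associative algebras over $\mathbb C$, $\otimes=\otimes_{\mathbb C}$, ideals are two-sided. **Differential algebras.** A differential algebra is an $\mathbb N$-graded algebra $\Gamma=\bigoplus_n\Gamma^n$ with a linear $d:\Gamma^n\to\Gamma^{n+1}$, $d^2=0$, satisfying the graded Leibniz rule; homomorphisms respect the product, the grading and $d$; differential ideals are graded $d$-invariant ideals. It is a differential algebra over $A$ if $\Gamma^0=A$, and a differential calculus $\Gamma(A)$ if moreover it is generated as an algebra by $A$ and the $da$, $a\in A$. $\Omega(A)$ denotes the universal differential calculus, $\hat\otimes$ the graded (skew) tensor product. A finite family of ideals $(K_i)_{i\in I}$ of $A$ is a covering if $\bigcap_iK_i=0$; its covering completion is $\{(a_i)_i\in\bigoplus_iA/K_i : a_i=a_j \text{ in } A/(K_i+K_j)\ \forall i,j\}$ (the same for differential ideals of a differential algebra), and the covering is complete if $A$ maps onto the completion. An LC-differential algebra over $A$ is a differential algebra $\Gamma$ over $A$ with a covering $(K_i)_{i\in I}$ by differential ideals such that each $\Gamma/K_i$ is a differential calculus over $A/K_i^0$ and $K_i^0:=K_i\cap A\neq0$; the $\Gamma/K_i$ are its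 local differential calculi. **The bundle.** Let $I$ be finite, $(J_i)_{i\in I}$ a complete covering of $B$ with $J_i\ne0$ for all $i$, $B_i=B/J_i$, $B_{ij}=B/(J_i+J_j)$, with projections $\pi_i:B\to B_i$, $\pi^i_j:B_i\to B_{ij}$. Let $H$ be a Hopf algebra, $P$ a right $H$-comodule algebra with coaction $\Delta_P$, $\iota:B\to P$ an injective homomorphism with image $\{p:\Delta_P(p)=p\otimes1\}$, and $\chi_i:P\to B_i\otimes H$ surjective homomorphisms with $(\mathrm{id}\otimes\Delta)\chi_i=(\chi_i\otimes \mathrm{id})\Delta_P$, $\chi_i(\iota(b))=\pi_i(b)\otimes1$, such that $(\ker\chi_i)_i$ is a complete covering of $P$ (a locally trivial quantum principal fibre bundle). **Its differential structure.** Let differential calculi $\Gamma(B_i)$ and a right covariant differential calculus $\Gamma(H)$ be given. Let $\chi_{i,\Omega\to\Gamma}:\Omega(P)\to\Gamma(B_i)\hat\otimes\Gamma(H)$ be the extension of $\chi_i$, $\Gamma(P)=\Omega(P)/\bigcap_i\ker\chi_{i,\Omega\to\Gamma}$, $\chi_{i\Gamma}:\Gamma(P)\to\Gamma(B_i)\hat\otimes\Gamma(H)$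 the induced surjection, and $\Gamma_c(P)$ the covering completion of $\Gamma(P)$ with respect to $(\ker\chi_{i\Gamma})_i$, with $\chi_{i\Gamma_c}:\Gamma_c(P)\to\Gamma(P)/\ker\chi_{i\Gamma}\cong\Gamma(B_i)\hat\otimes\Gamma(H)$ the $i$-th projection. **The algebra $\Gamma_m(B)$.** Put $\Gamma^i(B_{ij}\otimes H)=(\Gamma(B_i)\hat\otimes\Gamma(H))/\chi_{i\Gamma}(\ker\chi_{j\Gamma})$. Let $J^i(B_{ij}\otimes H)$ be the kernel of the homomorphism of differential algebras $\Omega(B_{ij}\otimes H)\to\Gamma^i(B_{ij}\otimes H)$ that extends $b\otimes h\mapsto[\tilde b\otimes h]$, where $\tilde b\in B_i$ is any lift of $b$, let $J_m(B_{ij})$ be its preimage in $\Omega(B_{ij})$ under the map induced by $b\mapsto b\otimes1$, and $\Gamma_m(B_{ij})=\Omega(B_{ij})/J_m(B_{ij})$. The projections $\pi^i_j,\pi^j_i$ extend to homomorphisms $\pi^i_{j\Gamma_m}:\Gamma(B_i)\to\Gamma_m(B_{ij})$ and $\pi^j_{i\Gamma_m}:\Gamma(B_j)\to\Gamma_m(B_{ij})$.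 Define $$\Gamma_m(B)=\Big\{(\gamma_i)_{i\in I}\in\bigoplus_{i\in I}\Gamma(B_i) : \pi^i_{j\Gamma_m}(\gamma_i)=\pi^j_{i\Gamma_m}(\gamma_j)\ \forall i,j\Big\},\qquad B\to\Gamma_m(B),\ b\mapsto(\pi_i(b))_i .$$ **Embeddability.** An LC-differential algebra $\Gamma_g(B)$ over $B$ is embeddable into $\Gamma_c(P)$ if its local differential calculi are the $\Gamma(B_i)$, i.e. it comes with surjective homomorphisms of differential algebras $\pi_{i\Gamma_g}:\Gamma_g(B)\to\Gamma(B_i)$ extending $\pi_i$ whose kernels are its covering ideals, and if there is a homomorphism of differential algebras $\iota_{\Gamma_g}:\Gamma_g(B)\to\Gamma_c(P)$ extending $\iota$ with $$\chi_{i\Gamma_c}(\iota_{\Gamma_g}(\gamma))=\pi_{i\Gamma_g}(\gamma)\,\hat\otimes\,1\qquad\forall\gamma\in\Gamma_g(B),\ i\in I.$$ **Proposition.** $\Gamma_m(B)$, with the coordinate projections $\Gamma_m(B)\to\Gamma(B_i)$, is an LC-differential algebra over $B$ which is embeddable into $\Gamma_c(P)$, and it is the maximal one: for every LC-differential algebra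 $\Gamma_g(B)$ over $B$ which is embeddable into $\Gamma_c(P)$, $\gamma\mapsto(\pi_{i\Gamma_g}(\gamma))_{i\in I}$ is an injective homomorphism of differential algebras $\Gamma_g(B)\to\Gamma_m(B)$ which is the identity on $B$. -/

import Mathlib

open scoped TensorProduct DirectSum

noncomputable section

/-- A differential algebra over `ℂ`: a unital associative `ℕ`-graded algebra `Γ = ⨁ₙ Γⁿ` with a
graded derivation `d` of degree one such that `d² = 0`. -/
structure DiffAlg where
  carrier : Type*
  [ring : Ring carrier]
  [algebra : Algebra ℂ carrier]
  deg : ℕ → Submodule ℂ carrier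
  internal : DirectSum.IsInternal deg
  one_mem : (1 : carrier) ∈ deg 0
  mul_mem : ∀ {m n : ℕ} {x y : carrier}, x ∈ deg m → y ∈ deg n → x * y ∈ deg (m + n)
  d : carrier →ₗ[ℂ] carrier
  d_mem : ∀ {n : ℕ} {x : carrier}, x ∈ deg n → d x ∈ deg (n + 1)
  leibniz : ∀ {n : ℕ} {x : carrier}, x ∈ deg n → ∀ y : carrier,
    d (x * y) = d x * y + (-1 : ℂ) ^ n • (x * d y)
  d_d : ∀ x : carrier, d (d x) = 0

namespace DiffAlg

instance : CoeSort DiffAlg (Type _) := ⟨DiffAlg.carrier⟩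

attribute [instance] DiffAlg.ring DiffAlg.algebra

/-- A criterion for a family of submodules to be an internal direct sum. -/
theorem isInternal_of_proj {M : Type*} [AddCommGroup M] [Module ℂ M] (deg : ℕ → Submodule ℂ M)
    (pr : ℕ → M →ₗ[ℂ] M) (h : ∀ m n x, x ∈ deg n → pr m x = if m = n then x else 0)
    (hs : ⨆ n, deg n = ⊤) : DirectSum.IsInternal deg := by
  classical
  have key : ∀ (m : ℕ) (x : ⨁ n, deg n),
      pr m (DirectSum.coeAddMonoidHom deg x) = (x m : M) := by
    intro m x
    induction x using DirectSum.induction_on with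
    | zero => simp
    | of i x =>
      rw [DirectSum.coeAddMonoidHom_of, h m i _ x.2]
      by_cases hm : m = i
      · subst hm; simp
      · rw [if_neg hm, DirectSum.of_eq_of_ne _ _ _ hm]; rfl
    | add x y hx hy => simp [hx, hy]
  constructor
  · rw [injective_iff_map_eq_zero]
    intro x hx
    ext m
    rw [← key m x, hx]; simp
  · intro y
    have hy : y ∈ ⨆ n, deg n := hs ▸ Submodule.mem_top
    induction hy using Submodule.iSup_induction' with
    | mem i x hx => exact ⟨DirectSum.of (fun n => deg n) i ⟨x, hx⟩, DirectSum.coeAddMonoidHom_of ..⟩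
    | zero => exact ⟨0, map_zero _⟩
    | add x y _ _ hx hy =>
      obtain ⟨a, rfl⟩ := hx
      obtain ⟨b, rfl⟩ := hy
      exact ⟨a + b, map_add _ _ _⟩

instance (Γ : DiffAlg) : SetLike.GradedMonoid Γ.deg where
  one_mem := Γ.one_mem
  mul_mem _ _ _ _ := Γ.mul_mem

instance (Γ : DiffAlg) : DirectSum.Decomposition Γ.deg := Γ.internal.chooseDecomposition

instance (Γ : DiffAlg) : GradedAlgebra Γ.deg where

/-- The projection onto the component of degree `n`. -/
def proj (Γ : DiffAlg) (n : ℕ) : Γ →ₗ[ℂ] Γ := GradedAlgebra.proj Γ.deg n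

theorem proj_of_mem (Γ : DiffAlg) (m n : ℕ) (x : Γ) (hx : x ∈ Γ.deg n) :
    Γ.proj m x = if m = n then x else 0 := by
  rw [proj, GradedAlgebra.proj_apply]
  by_cases h : m = n
  · subst h; rw [if_pos rfl, DirectSum.decompose_of_mem_same _ hx]
  · rw [if_neg h, DirectSum.decompose_of_mem_ne _ hx (Ne.symm h)]

theorem proj_mem (Γ : DiffAlg) (n : ℕ) (x : Γ) : Γ.proj n x ∈ Γ.deg n := by
  rw [proj, GradedAlgebra.proj_apply]; exact SetLike.coe_mem _

theorem iSup_deg (Γ : DiffAlg) : ⨆ n, Γ.deg n = ⊤ := Γ.internal.submodule_iSup_eq_top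

theorem exists_sum_proj (Γ : DiffAlg) (x : Γ) : ∃ s : Finset ℕ, ∀ t : Finset ℕ, s ⊆ t →
    ∑ n ∈ t, Γ.proj n x = x := by
  classical
  refine ⟨(DirectSum.decompose Γ.deg x).support, fun t ht => ?_⟩
  rw [← Finset.sum_subset ht]
  · exact DirectSum.sum_support_decompose Γ.deg x
  · intro n _ hn
    rw [DFinsupp.notMem_support_iff] at hn
    rw [proj, GradedAlgebra.proj_apply, hn]; rfl

/-- Induction on homogeneous elements. -/
theorem hom_induction (Γ : DiffAlg) {p : Γ → Prop} (x : Γ)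
    (hom : ∀ n, ∀ y ∈ Γ.deg n, p y) (zero : p 0) (add : ∀ y z, p y → p z → p (y + z)) : p x := by
  have hx : x ∈ ⨆ n, Γ.deg n := Γ.iSup_deg ▸ Submodule.mem_top
  induction hx using Submodule.iSup_induction' with
  | mem i x hx => exact hom i x hx
  | zero => exact zero
  | add x y _ _ hx hy => exact add _ _ hx hy

/-! ### Homomorphisms of differential algebras -/

/-- Homomorphisms of differential algebras: algebra homomorphisms which respect the grading and
commute with the differentials. -/
structure Hom (Γ Λ : DiffAlg) extends Γ.carrier →ₐ[ℂ] Λ.carrier where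
  map_deg : ∀ {n : ℕ} {x : Γ}, x ∈ Γ.deg n → toFun x ∈ Λ.deg n
  map_d : ∀ x : Γ, toFun (Γ.d x) = Λ.d (toFun x)

namespace Hom

variable {Γ Λ Θ : DiffAlg}

instance : CoeFun (Hom Γ Λ) fun _ => Γ → Λ := ⟨fun f => f.toAlgHom⟩

theorem map_mem (f : Hom Γ Λ) {n : ℕ} {x : Γ} (hx : x ∈ Γ.deg n) : f x ∈ Λ.deg n := f.map_deg hx

theorem comm_d (f : Hom Γ Λ) (x : Γ) : f (Γ.d x) = Λ.d (f x) := f.map_d x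

theorem map_proj (f : Hom Γ Λ) (n : ℕ) (x : Γ) : f (Γ.proj n x) = Λ.proj n (f x) := by
  induction x using Γ.hom_induction with
  | hom m y hy =>
    rw [Γ.proj_of_mem n m y hy, Λ.proj_of_mem n m _ (f.map_mem hy)]
    split_ifs <;> simp
  | zero => simp
  | add y z hy hz => simp [hy, hz]

/-- Composition of homomorphisms of differential algebras. -/
def comp (g : Hom Λ Θ) (f : Hom Γ Λ) : Hom Γ Θ where
  toAlgHom := g.toAlgHom.comp f.toAlgHom
  map_deg hx := g.map_mem (f.map_mem hx)
  map_d x := by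
    change g (f (Γ.d x)) = Θ.d (g (f x))
    rw [f.comm_d, g.comm_d]

@[simp] theorem comp_apply (g : Hom Λ Θ) (f : Hom Γ Λ) (x : Γ) : g.comp f x = g (f x) := rfl

end Hom

/-! ### Differential ideals and quotients -/

/-- Differential ideals: two-sided ideals which are graded and `d`-invariant. -/
structure DiffIdeal (Γ : DiffAlg) where
  ideal : Ideal Γ
  twoSided : ideal.IsTwoSided
  graded : ∀ (n : ℕ) {x : Γ}, x ∈ ideal → Γ.proj n x ∈ ideal
  d_mem : ∀ {x : Γ}, x ∈ ideal → Γ.d x ∈ ideal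

attribute [instance] DiffIdeal.twoSided

namespace DiffIdeal

variable {Γ Λ : DiffAlg}

/-- The preimage of a differential ideal under a homomorphism. -/
def comap (f : Hom Γ Λ) (J : DiffIdeal Λ) : DiffIdeal Γ where
  ideal := J.ideal.comap f.toAlgHom
  twoSided := inferInstance
  graded n x hx := by
    change f (Γ.proj n x) ∈ J.ideal
    rw [f.map_proj]
    exact J.graded n hx
  d_mem {x} hx := by
    change f (Γ.d x) ∈ J.ideal
    rw [f.comm_d]
    exact J.d_mem hx

/-- The kernel of a homomorphism of differential algebras. -/
def ker (f : Hom Γ Λ) : DiffIdeal Γ where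
  ideal := RingHom.ker f.toAlgHom
  twoSided := inferInstance
  graded n x hx := by
    change f (Γ.proj n x) = 0
    have hx : f x = 0 := hx
    rw [f.map_proj, hx, map_zero]
  d_mem {x} hx := by
    change f (Γ.d x) = 0
    have hx : f x = 0 := hx
    rw [f.comm_d, hx, map_zero]

/-- The intersection of a family of differential ideals. -/
def inf {I : Type*} (K : I → DiffIdeal Γ) : DiffIdeal Γ where
  ideal := ⨅ i, (K i).ideal
  twoSided := inferInstance
  graded n x hx := by
    rw [Submodule.mem_iInf] at hx ⊢
    exact fun i => (K i).graded n (hx i)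
  d_mem {x} hx := by
    rw [Submodule.mem_iInf] at hx ⊢
    exact fun i => (K i).d_mem (hx i)

/-- The sum of two-sided ideals is two-sided. -/
theorem sup_isTwoSided {A : Type*} [Ring A] (J K : Ideal A) [J.IsTwoSided] [K.IsTwoSided] :
    (J ⊔ K).IsTwoSided := by
  refine ⟨fun b ha => ?_⟩
  obtain ⟨x, hx, y, hy, rfl⟩ := Submodule.mem_sup.mp ha
  rw [add_mul]
  exact Submodule.add_mem_sup (J.mul_mem_right b hx) (K.mul_mem_right b hy)

/-- The sum of two differential ideals. -/
def sup (J K : DiffIdeal Γ) : DiffIdeal Γ where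
  ideal := J.ideal ⊔ K.ideal
  twoSided := sup_isTwoSided _ _
  graded n x hx := by
    obtain ⟨x, hx', y, hy, rfl⟩ := Submodule.mem_sup.mp hx
    rw [map_add]
    exact Submodule.add_mem_sup (J.graded n hx') (K.graded n hy)
  d_mem {x} hx := by
    obtain ⟨x, hx', y, hy, rfl⟩ := Submodule.mem_sup.mp hx
    rw [map_add]
    exact Submodule.add_mem_sup (J.d_mem hx') (K.d_mem hy)

/-- The image of a differential ideal under a surjective homomorphism. -/
def map (f : Hom Γ Λ) (hf : Function.Surjective f) (J : DiffIdeal Γ) : DiffIdeal Λ where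
  ideal := J.ideal.map f.toAlgHom
  twoSided := by
    refine ⟨fun b ha => ?_⟩
    obtain ⟨x, hx, rfl⟩ := (Ideal.mem_map_iff_of_surjective f.toAlgHom hf).mp ha
    obtain ⟨y, rfl⟩ := hf b
    rw [← map_mul]
    exact Ideal.mem_map_of_mem _ (J.ideal.mul_mem_right y hx)
  graded n x hx := by
    obtain ⟨x, hx', rfl⟩ := (Ideal.mem_map_iff_of_surjective f.toAlgHom hf).mp hx
    rw [← f.map_proj]
    exact Ideal.mem_map_of_mem _ (J.graded n hx')
  d_mem {x} hx := by
    obtain ⟨x, hx', rfl⟩ := (Ideal.mem_map_iff_of_surjective f.toAlgHom hf).mp hx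
    rw [← f.comm_d]
    exact Ideal.mem_map_of_mem _ (J.d_mem hx')

/-- The factor differential algebra `Γ/J`. -/
def quot (J : DiffIdeal Γ) : DiffAlg where
  carrier := Γ.carrier ⧸ J.ideal
  deg n := (Γ.deg n).map (Ideal.Quotient.mkₐ ℂ J.ideal).toLinearMap
  internal := by
    let q := (Ideal.Quotient.mkₐ ℂ J.ideal).toLinearMap
    let pr : ℕ → (Γ.carrier ⧸ J.ideal) →ₗ[ℂ] (Γ.carrier ⧸ J.ideal) := fun n =>
      { toFun := Quotient.lift (fun x => q (Γ.proj n x)) (by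
          intro a b hab
          have hab : a - b ∈ J.ideal := (Submodule.quotientRel_def _).mp hab
          have := J.graded n hab
          rw [map_sub] at this
          exact Ideal.Quotient.eq.mpr this)
        map_add' := by
          rintro ⟨x⟩ ⟨y⟩
          change q (Γ.proj n (x + y)) = q _ + q _
          rw [map_add, map_add]
        map_smul' := by
          rintro c ⟨x⟩
          change q (Γ.proj n (c • x)) = c • q _
          rw [map_smul, map_smul] }
    refine isInternal_of_proj _ pr ?_ ?_
    · rintro m n _ ⟨x, hx, rfl⟩
      change q (Γ.proj m x) = if m = n then q x else 0
      rw [Γ.proj_of_mem m n x hx]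
      split_ifs <;> simp
    · rw [← Submodule.map_iSup, Γ.iSup_deg, Submodule.map_top, LinearMap.range_eq_top]
      exact Ideal.Quotient.mk_surjective
  one_mem := ⟨1, Γ.one_mem, map_one (Ideal.Quotient.mkₐ ℂ J.ideal)⟩
  mul_mem := by
    rintro m n _ _ ⟨x, hx, rfl⟩ ⟨y, hy, rfl⟩
    exact ⟨x * y, Γ.mul_mem hx hy, map_mul (Ideal.Quotient.mkₐ ℂ J.ideal) x y⟩
  d :=
    { toFun := Quotient.lift (fun x => Ideal.Quotient.mkₐ ℂ J.ideal (Γ.d x)) (by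
          intro a b hab
          have hab : a - b ∈ J.ideal := (Submodule.quotientRel_def _).mp hab
          have := J.d_mem hab
          rw [map_sub] at this
          exact Ideal.Quotient.eq.mpr this)
      map_add' := by
          rintro ⟨x⟩ ⟨y⟩
          change Ideal.Quotient.mkₐ ℂ J.ideal (Γ.d (x + y)) = Ideal.Quotient.mkₐ ℂ J.ideal _ +
            Ideal.Quotient.mkₐ ℂ J.ideal _
          rw [map_add, map_add]
      map_smul' := by
          rintro c ⟨x⟩
          change Ideal.Quotient.mkₐ ℂ J.ideal (Γ.d (c • x)) = c • Ideal.Quotient.mkₐ ℂ J.ideal _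
          rw [map_smul, map_smul] }
  d_mem := by
    rintro n _ ⟨x, hx, rfl⟩
    exact ⟨Γ.d x, Γ.d_mem hx, rfl⟩
  leibniz := by
    rintro n _ ⟨x, hx, rfl⟩ ⟨y⟩
    change Ideal.Quotient.mkₐ ℂ J.ideal (Γ.d (x * y)) =
      Ideal.Quotient.mkₐ ℂ J.ideal (Γ.d x) * Ideal.Quotient.mkₐ ℂ J.ideal y +
      (-1 : ℂ) ^ n • (Ideal.Quotient.mkₐ ℂ J.ideal x * Ideal.Quotient.mkₐ ℂ J.ideal (Γ.d y))
    rw [Γ.leibniz hx y, map_add, map_mul, map_smul, map_mul]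
  d_d := by
    rintro ⟨x⟩
    change Ideal.Quotient.mkₐ ℂ J.ideal (Γ.d (Γ.d x)) = 0
    rw [Γ.d_d, map_zero]

/-- The canonical projection `Γ → Γ/J`. -/
def toQuot (J : DiffIdeal Γ) : Hom Γ J.quot where
  toAlgHom := Ideal.Quotient.mkₐ ℂ J.ideal
  map_deg hx := ⟨_, hx, rfl⟩
  map_d _ := rfl

theorem toQuot_surjective (J : DiffIdeal Γ) : Function.Surjective J.toQuot := Ideal.Quotient.mk_surjective

theorem toQuot_eq_zero (J : DiffIdeal Γ) (x : Γ) : J.toQuot x = 0 ↔ x ∈ J.ideal :=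
  Ideal.Quotient.eq_zero_iff_mem

/-- The homomorphism `Γ/J → Λ` induced by a homomorphism `Γ → Λ` which vanishes on `J`. -/
def lift (J : DiffIdeal Γ) (f : Hom Γ Λ) (hf : ∀ x ∈ J.ideal, f x = 0) : Hom J.quot Λ where
  toAlgHom := Ideal.Quotient.liftₐ J.ideal f.toAlgHom hf
  map_deg := by
    rintro n _ ⟨x, hx, rfl⟩
    exact f.map_mem hx
  map_d := by
    rintro ⟨x⟩
    exact f.comm_d x

@[simp] theorem lift_toQuot (J : DiffIdeal Γ) (f : Hom Γ Λ) (hf : ∀ x ∈ J.ideal, f x = 0) (x : Γ) :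
    J.lift f hf (J.toQuot x) = f x := rfl

end DiffIdeal

/-- The homomorphism `Λ → Θ` induced by `f : Γ → Θ`, where `q : Γ → Λ` is surjective and `f`
vanishes on the kernel of `q`. -/
def Hom.factor {Γ Λ Θ : DiffAlg} (q : Hom Γ Λ) (hq : Function.Surjective q) (f : Hom Γ Θ)
    (hf : ∀ x, q x = 0 → f x = 0) : Hom Λ Θ :=
  have key : ∀ x, f (Function.surjInv hq (q x)) = f x := fun x => by
    rw [← sub_eq_zero, ← map_sub]
    apply hf
    rw [map_sub, Function.surjInv_eq hq, sub_self]
  { toFun := fun y => f (Function.surjInv hq y)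
    map_one' := by rw [← map_one q.toAlgHom]; exact (key 1).trans (map_one _)
    map_zero' := by rw [← map_zero q.toAlgHom]; exact (key 0).trans (map_zero _)
    map_mul' := by
      intro y z
      obtain ⟨y, rfl⟩ := hq y
      obtain ⟨z, rfl⟩ := hq z
      rw [← map_mul, key, key, key, map_mul]
    map_add' := by
      intro y z
      obtain ⟨y, rfl⟩ := hq y
      obtain ⟨z, rfl⟩ := hq z
      rw [← map_add, key, key, key, map_add]
    commutes' := by
      intro c
      rw [← q.toAlgHom.commutes c]
      exact (key _).trans (f.toAlgHom.commutes c)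
    map_deg := by
      intro n y hy
      obtain ⟨x, rfl⟩ := hq y
      have h : q x = q (Γ.proj n x) := by
        rw [q.map_proj, Λ.proj_of_mem n n _ hy, if_pos rfl]
      change f (Function.surjInv hq (q x)) ∈ _
      rw [h, key]
      exact f.map_mem (Γ.proj_mem n x)
    map_d := by
      intro y
      obtain ⟨x, rfl⟩ := hq y
      rw [← q.comm_d, key, key, f.comm_d] }

theorem Hom.factor_apply {Γ Λ Θ : DiffAlg} (q : Hom Γ Λ) (hq : Function.Surjective q)
    (f : Hom Γ Θ) (hf : ∀ x, q x = 0 → f x = 0) (x : Γ) : q.factor hq f hf (q x) = f x := by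
  change f (Function.surjInv hq (q x)) = f x
  rw [← sub_eq_zero, ← map_sub]
  apply hf
  rw [map_sub, Function.surjInv_eq hq, sub_self]

/-! ### Gluing -/

section Gluing

variable {I : Type*} [Finite I] (Γ : I → DiffAlg) (Λ : I → I → DiffAlg)
  (p : ∀ i j, Hom (Γ i) (Λ i j)) (q : ∀ i j, Hom (Γ j) (Λ i j))

/-- The algebra `{(γᵢ) ∈ ⨁ᵢ Γᵢ | pᵢⱼ(γᵢ) = qᵢⱼ(γⱼ)}`. -/
def gluingAlgebra : Subalgebra ℂ (∀ i, Γ i) where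
  carrier := {x | ∀ i j, p i j (x i) = q i j (x j)}
  mul_mem' {x y} hx hy i j := by
    change p i j (x i * y i) = q i j (x j * y j)
    rw [map_mul, map_mul, hx i j, hy i j]
  add_mem' {x y} hx hy i j := by
    change p i j (x i + y i) = q i j (x j + y j)
    rw [map_add, map_add, hx i j, hy i j]
  algebraMap_mem' c i j := by
    change p i j (algebraMap ℂ _ c) = q i j (algebraMap ℂ _ c)
    rw [AlgHom.commutes, AlgHom.commutes]

/-- The gluing `{(γᵢ) ∈ ⨁ᵢ Γᵢ | pᵢⱼ(γᵢ) = qᵢⱼ(γⱼ)}` of a finite family of differential algebras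
`Γᵢ` along the differential algebras `Λᵢⱼ` by means of `pᵢⱼ : Γᵢ → Λᵢⱼ` and `qᵢⱼ : Γⱼ → Λᵢⱼ`, with
componentwise grading and differential. -/
def gluing : DiffAlg where
  carrier := gluingAlgebra Γ Λ p q
  deg n :=
    { carrier := {x | ∀ i, x.1 i ∈ (Γ i).deg n}
      add_mem' := fun hx hy i => (Γ i |>.deg n).add_mem (hx i) (hy i)
      zero_mem' := fun i => (Γ i |>.deg n).zero_mem
      smul_mem' := fun c _ hx i => (Γ i |>.deg n).smul_mem c (hx i) }
  internal := by
    classical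
    have := Fintype.ofFinite I
    let pr : ℕ → gluingAlgebra Γ Λ p q →ₗ[ℂ] gluingAlgebra Γ Λ p q := fun n =>
      { toFun := fun x => ⟨fun i => (Γ i).proj n (x.1 i), fun i j => by
          rw [(p i j).map_proj, (q i j).map_proj, x.2 i j]⟩
        map_add' := fun x y => Subtype.ext (funext fun i => map_add ((Γ i).proj n) _ _)
        map_smul' := fun c x => Subtype.ext (funext fun i => map_smul ((Γ i).proj n) _ _) }
    refine isInternal_of_proj _ pr ?_ ?_
    · intro m n x hx
      apply Subtype.ext
      funext i
      change (Γ i).proj m (x.1 i) = _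
      rw [(Γ i).proj_of_mem m n _ (hx i)]
      split_ifs <;> rfl
    · rw [eq_top_iff]
      rintro x -
      choose s hs using fun i => (Γ i).exists_sum_proj (x.1 i)
      have hx : x = ∑ n ∈ Finset.univ.biUnion s, pr n x := by
        apply Subtype.ext
        funext i
        rw [AddSubmonoidClass.coe_finsetSum, Finset.sum_apply]
        exact (hs i _ (Finset.subset_biUnion_of_mem s (Finset.mem_univ i))).symm
      rw [hx]
      exact Submodule.sum_mem _ fun n _ =>
        Submodule.mem_iSup_of_mem n fun i => (Γ i).proj_mem n (x.1 i)
  one_mem i := (Γ i).one_mem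
  mul_mem hx hy i := (Γ i).mul_mem (hx i) (hy i)
  d :=
    { toFun := fun x => ⟨fun i => (Γ i).d (x.1 i), fun i j => by
        rw [(p i j).comm_d, (q i j).comm_d, x.2 i j]⟩
      map_add' := fun x y => Subtype.ext (funext fun i => map_add (Γ i).d _ _)
      map_smul' := fun c x => Subtype.ext (funext fun i => map_smul (Γ i).d _ _) }
  d_mem hx i := (Γ i).d_mem (hx i)
  leibniz hx y := Subtype.ext (funext fun i => (Γ i).leibniz (hx i) (y.1 i))
  d_d x := Subtype.ext (funext fun i => (Γ i).d_d (x.1 i))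

/-- The restriction `(γₖ)ₖ ↦ γᵢ` of the `i`-th projection to the gluing. -/
def gluingProj (i : I) : Hom (gluing Γ Λ p q) (Γ i) where
  toAlgHom := (Pi.evalAlgHom ℂ (fun i => (Γ i).carrier) i).comp (gluingAlgebra Γ Λ p q).val
  map_deg hx := hx i
  map_d _ := rfl

/-- The covering completion of a differential algebra `Γ` with respect to a finite family `(Kᵢ)` of
differential ideals: the gluing of the `Γ/Kᵢ` along the `Γ/(Kᵢ + Kⱼ)` by means of the canonical
projections. -/
def completion (Γ : DiffAlg) (K : I → DiffIdeal Γ) : DiffAlg :=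
  gluing (fun i => (K i).quot) (fun i j => ((K i).sup (K j)).quot)
    (fun i j => (K i).lift ((K i).sup (K j)).toQuot fun x hx =>
      (DiffIdeal.toQuot_eq_zero _ x).mpr (Submodule.mem_sup_left hx))
    (fun i j => (K j).lift ((K i).sup (K j)).toQuot fun x hx =>
      (DiffIdeal.toQuot_eq_zero _ x).mpr (Submodule.mem_sup_right hx))

/-- The `i`-th projection from the covering completion. -/
def completionProj (Γ : DiffAlg) (K : I → DiffIdeal Γ) (i : I) :
    Hom (completion Γ K) (K i).quot :=
  gluingProj _ _ _ _ i

/-- The canonical homomorphism `x ↦ (x + Kᵢ)ᵢ` from `Γ` to its covering completion. -/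
def toCompletion (Γ : DiffAlg) (K : I → DiffIdeal Γ) : Hom Γ (completion Γ K) where
  toFun x := ⟨fun i => (K i).toQuot x, fun _ _ => rfl⟩
  map_one' := rfl
  map_zero' := rfl
  map_mul' _ _ := rfl
  map_add' _ _ := rfl
  commutes' _ := rfl
  map_deg hx i := (K i).toQuot.map_mem hx
  map_d _ := rfl

end Gluing

/-! ### The skew tensor product -/

section Skew

open TensorProduct

variable (Γ Λ : DiffAlg)

/-- The grading operator `γ ↦ (-1)ⁿ γ` for `γ` of degree `n`. -/
def sign : Γ →ₗ[ℂ] Γ :=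
  (DirectSum.toModule ℂ ℕ Γ fun n => (-1 : ℂ) ^ n • (Γ.deg n).subtype) ∘ₗ
    (DirectSum.decomposeLinearEquiv Γ.deg).toLinearMap

theorem sign_of_mem {n : ℕ} {x : Γ} (hx : x ∈ Γ.deg n) : Γ.sign x = (-1 : ℂ) ^ n • x := by
  rw [sign, LinearMap.comp_apply]
  change DirectSum.toModule ℂ ℕ Γ _ (DirectSum.decompose Γ.deg x) = _
  rw [DirectSum.decompose_of_mem _ hx, ← DirectSum.lof_eq_of ℂ, DirectSum.toModule_lof]
  rfl

/-- The underlying algebra of the skew tensor product: the vector space `Γ ⊗ Λ` with the product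
`(γ ⊗ ρ)(ω ⊗ τ) = (-1)ᵐⁿ γω ⊗ ρτ` for `ρ ∈ Λᵐ`, `ω ∈ Γⁿ`. -/
abbrev SkewTensor : Type _ := Γ.deg ᵍ⊗[ℂ] Λ.deg

variable {Γ Λ} in
/-- The element `γ ⊗ ρ` of the skew tensor product. -/
abbrev stmul (x : Γ) (y : Λ) : SkewTensor Γ Λ := GradedTensorProduct.tmul ℂ x y

theorem stmul_mul {m n : ℕ} (x : Γ) {y : Λ} {z : Γ} (w : Λ) (hy : y ∈ Λ.deg m)
    (hz : z ∈ Γ.deg n) :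
    stmul x y * stmul z w = (-1 : ℂ) ^ (m * n) • stmul (x * z) (y * w) := by
  have h := GradedTensorProduct.tmul_coe_mul_coe_tmul (R := ℂ) Γ.deg Λ.deg x ⟨y, hy⟩ ⟨z, hz⟩ w
  refine h.trans ?_
  rcases Nat.even_or_odd (m * n) with e | e
  · rw [e.neg_one_pow, e.neg_one_pow, one_smul, one_smul]
  · rw [e.neg_one_pow, e.neg_one_pow, neg_smul, Units.neg_smul, one_smul, one_smul]

theorem skew_induction {p : SkewTensor Γ Λ → Prop} (x : SkewTensor Γ Λ)
    (hom : ∀ m n, ∀ a ∈ Γ.deg m, ∀ b ∈ Λ.deg n, p (stmul a b)) (zero : p 0)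
    (add : ∀ y z, p y → p z → p (y + z)) : p x := by
  refine TensorProduct.induction_on (motive := p) x zero (fun a b => ?_) add
  induction a using Γ.hom_induction with
  | hom m a ha =>
    induction b using Λ.hom_induction with
    | hom n b hb => exact hom m n a ha b hb
    | zero => rw [TensorProduct.tmul_zero]; exact zero
    | add b c hb hc => rw [TensorProduct.tmul_add]; exact add _ _ hb hc
  | zero => rw [TensorProduct.zero_tmul]; exact zero
  | add a c ha hc => rw [TensorProduct.add_tmul]; exact add _ _ ha hc

/-- The component of degree `n` of the skew tensor product: `⨁_{k + l = n} Γᵏ ⊗ Λˡ`. -/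
def skewDeg (n : ℕ) : Submodule ℂ (SkewTensor Γ Λ) :=
  Submodule.span ℂ {x | ∃ k l, k + l = n ∧ ∃ a ∈ Γ.deg k, ∃ b ∈ Λ.deg l, stmul a b = x}

variable {Γ Λ} in
theorem stmul_mem {k l : ℕ} {a : Γ} {b : Λ} (ha : a ∈ Γ.deg k) (hb : b ∈ Λ.deg l) :
    stmul a b ∈ skewDeg Γ Λ (k + l) :=
  Submodule.subset_span ⟨k, l, rfl, a, ha, b, hb, rfl⟩

/-- The differential `d(γ ⊗ ρ) = dγ ⊗ ρ + (-1)ⁿ γ ⊗ dρ`, `γ ∈ Γⁿ`, of the skew tensor product. -/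
def skewD : SkewTensor Γ Λ →ₗ[ℂ] SkewTensor Γ Λ :=
  (GradedTensorProduct.of ℂ Γ.deg Λ.deg).toLinearMap ∘ₗ
    (TensorProduct.map Γ.d LinearMap.id + TensorProduct.map Γ.sign Λ.d) ∘ₗ
      (GradedTensorProduct.of ℂ Γ.deg Λ.deg).symm.toLinearMap

variable {Γ Λ} in
theorem stmul_smul (c : ℂ) (a : Γ) (b : Λ) : stmul a (c • b) = c • stmul a b := by
  rw [stmul, stmul, GradedTensorProduct.tmul, TensorProduct.tmul_smul, map_smul]

variable {Γ Λ} in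
theorem smul_stmul (c : ℂ) (a : Γ) (b : Λ) : stmul (c • a) b = c • stmul a b := by
  rw [stmul, stmul, GradedTensorProduct.tmul, ← TensorProduct.smul_tmul', map_smul]

variable {Γ Λ} in
theorem stmul_zero (a : Γ) : stmul a (0 : Λ) = 0 := by
  rw [stmul, GradedTensorProduct.tmul, TensorProduct.tmul_zero, map_zero]

variable {Γ Λ} in
theorem zero_stmul (b : Λ) : stmul (0 : Γ) b = 0 := by
  rw [stmul, GradedTensorProduct.tmul, TensorProduct.zero_tmul, map_zero]

variable {Γ Λ} in
theorem stmul_add (a : Γ) (b c : Λ) : stmul a (b + c) = stmul a b + stmul a c := by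
  rw [stmul, GradedTensorProduct.tmul, TensorProduct.tmul_add, map_add]

variable {Γ Λ} in
theorem add_stmul (a c : Γ) (b : Λ) : stmul (a + c) b = stmul a b + stmul c b := by
  rw [stmul, GradedTensorProduct.tmul, TensorProduct.add_tmul, map_add]

theorem skewD_stmul {n : ℕ} {a : Γ} (ha : a ∈ Γ.deg n) (b : Λ) :
    skewD Γ Λ (stmul a b) = stmul (Γ.d a) b + (-1 : ℂ) ^ n • stmul a (Λ.d b) := by
  rw [← smul_stmul, ← Γ.sign_of_mem ha]
  rfl

/-- The skew tensor product `Γ ⊗̂ Λ` of differential algebras. -/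
def skew : DiffAlg where
  carrier := SkewTensor Γ Λ
  deg := skewDeg Γ Λ
  internal := by
    let pr : ℕ → SkewTensor Γ Λ →ₗ[ℂ] SkewTensor Γ Λ := fun n =>
      (GradedTensorProduct.of ℂ Γ.deg Λ.deg).toLinearMap ∘ₗ
        (∑ kl ∈ Finset.HasAntidiagonal.antidiagonal n, TensorProduct.map (Γ.proj kl.1) (Λ.proj kl.2)) ∘ₗ
          (GradedTensorProduct.of ℂ Γ.deg Λ.deg).symm.toLinearMap
    have hpr : ∀ n a b, pr n (stmul a b) =
        ∑ kl ∈ Finset.HasAntidiagonal.antidiagonal n, stmul (Γ.proj kl.1 a) (Λ.proj kl.2 b) := by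
      intro n a b
      simp [pr, stmul]
    refine isInternal_of_proj _ pr ?_ ?_
    · intro m n x hx
      induction hx using Submodule.span_induction with
      | mem x hx =>
        obtain ⟨k, l, rfl, a, ha, b, hb, rfl⟩ := hx
        rw [hpr]
        have : ∀ kl ∈ Finset.HasAntidiagonal.antidiagonal m, stmul (Γ.proj kl.1 a) (Λ.proj kl.2 b) =
            if kl = (k, l) then stmul a b else 0 := by
          rintro ⟨k', l'⟩ -
          rw [Γ.proj_of_mem _ k a ha, Λ.proj_of_mem _ l b hb]
          by_cases h1 : k' = k <;> by_cases h2 : l' = l <;> simp [h1, h2, stmul]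
        rw [Finset.sum_congr rfl this, Finset.sum_ite_eq']
        simp [eq_comm]
      | zero => simp
      | add x y _ _ hx hy => rw [map_add, hx, hy]; split_ifs <;> simp
      | smul c x _ hx => rw [map_smul, hx]; split_ifs <;> simp
    · rw [eq_top_iff]
      rintro x -
      induction x using skew_induction with
      | hom m n a ha b hb => exact Submodule.mem_iSup_of_mem (m + n) (stmul_mem ha hb)
      | zero => exact zero_mem _
      | add y z hy hz => exact add_mem hy hz
  one_mem := Submodule.subset_span ⟨0, 0, rfl, 1, Γ.one_mem, 1, Λ.one_mem, rfl⟩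
  mul_mem := by
    intro m n x y hx hy
    induction hx using Submodule.span_induction with
    | mem x hx =>
      obtain ⟨k, l, rfl, a, ha, b, hb, rfl⟩ := hx
      induction hy using Submodule.span_induction with
      | mem y hy =>
        obtain ⟨k', l', rfl, a', ha', b', hb', rfl⟩ := hy
        rw [stmul_mul Γ Λ a b' hb ha', add_add_add_comm]
        exact Submodule.smul_mem _ _ (stmul_mem (Γ.mul_mem ha ha') (Λ.mul_mem hb hb'))
      | zero => rw [mul_zero]; exact zero_mem _
      | add y z _ _ hy hz => rw [mul_add]; exact add_mem hy hz
      | smul c y _ hy => rw [mul_smul_comm]; exact Submodule.smul_mem _ _ hy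
    | zero => rw [zero_mul]; exact zero_mem _
    | add y z _ _ hy hz => rw [add_mul]; exact add_mem hy hz
    | smul c y _ hy => rw [smul_mul_assoc]; exact Submodule.smul_mem _ _ hy
  d := skewD Γ Λ
  d_mem := by
    intro n x hx
    induction hx using Submodule.span_induction with
    | mem x hx =>
      obtain ⟨k, l, rfl, a, ha, b, hb, rfl⟩ := hx
      rw [skewD_stmul Γ Λ ha]
      refine add_mem ?_ (Submodule.smul_mem _ _ ?_)
      · rw [add_right_comm]
        exact stmul_mem (Γ.d_mem ha) hb
      · rw [add_assoc]; exact stmul_mem ha (Λ.d_mem hb)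
    | zero => rw [map_zero]; exact zero_mem _
    | add y z _ _ hy hz => rw [map_add]; exact add_mem hy hz
    | smul c y _ hy => rw [map_smul]; exact Submodule.smul_mem _ _ hy
  leibniz := by
    intro n x hx y
    induction hx using Submodule.span_induction with
    | mem x hx =>
      obtain ⟨i, j, rfl, a, ha, b, hb, rfl⟩ := hx
      induction y using skew_induction with
      | hom k l c hc e he =>
        rw [stmul_mul Γ Λ a e hb hc, map_smul, skewD_stmul Γ Λ (Γ.mul_mem ha hc),
          skewD_stmul Γ Λ ha, skewD_stmul Γ Λ hc, Γ.leibniz ha, Λ.leibniz hb, add_mul, mul_add,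
          stmul_mul Γ Λ _ e hb hc, smul_mul_assoc, stmul_mul Γ Λ a e (Λ.d_mem hb) hc,
          stmul_mul Γ Λ a e hb (Γ.d_mem hc), mul_smul_comm, stmul_mul Γ Λ a _ hb hc]
        rw [add_stmul, stmul_add, smul_stmul, stmul_smul]
        have h2 : ∀ t : ℕ, ((-1 : ℂ) ^ t) * ((-1 : ℂ) ^ t) = 1 := fun t => by
          rw [← mul_pow]; norm_num
        simp only [smul_add, smul_smul]
        rw [add_assoc, add_assoc]
        congr 1
        have s1 : (-1 : ℂ) ^ (j * k) * (-1) ^ i = (-1) ^ (i + j) * (-1) ^ (j * (k + 1)) := by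
          rw [mul_add, mul_one, pow_add, pow_add]
          linear_combination (-(-1 : ℂ) ^ (j * k) * (-1) ^ i) * h2 j
        have s2 : (-1 : ℂ) ^ (j * k) * (-1) ^ (i + k) = (-1) ^ i * (-1) ^ ((j + 1) * k) := by
          rw [add_mul, one_mul, pow_add, pow_add]; ring
        have s3 : (-1 : ℂ) ^ (j * k) * ((-1) ^ (i + k) * (-1) ^ j) =
            (-1) ^ (i + j) * ((-1) ^ k * (-1) ^ (j * k)) := by
          rw [pow_add, pow_add]; ring
        rw [← s1, s2, s3]
        abel
      | zero => simp
      | add y z hy hz => rw [mul_add, map_add, hy, hz, map_add, mul_add, mul_add, smul_add]; abel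
    | zero => simp
    | add x z _ _ hx hz => rw [add_mul, map_add, hx, hz, map_add, add_mul, add_mul, smul_add]; abel
    | smul c x _ hx =>
      rw [smul_mul_assoc, map_smul, hx, map_smul, smul_mul_assoc, smul_add, smul_mul_assoc,
        smul_comm c]
  d_d := by
    intro x
    induction x using skew_induction with
    | hom m n a ha b hb =>
      rw [skewD_stmul Γ Λ ha, map_add, map_smul, skewD_stmul Γ Λ (Γ.d_mem ha),
        skewD_stmul Γ Λ ha, Γ.d_d, Λ.d_d]
      rw [zero_stmul, stmul_zero, smul_zero, add_zero, zero_add, pow_succ, mul_neg_one, neg_smul, neg_add_cancel]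
    | zero => simp
    | add y z hy hz => rw [map_add, map_add, hy, hz, add_zero]

end Skew

end DiffAlg

namespace DiffAlg

/-! ### The universal differential calculus -/

section Omega

variable (A : Type*) [Ring A] [Algebra ℂ A]

/-- The relations between the generators `a` (`Sum.inl a`) and `da` (`Sum.inr a`), `a ∈ A`, of the
universal differential calculus. -/
inductive OmegaRel : FreeAlgebra ℂ (A ⊕ A) → FreeAlgebra ℂ (A ⊕ A) → Prop
  | one : OmegaRel (FreeAlgebra.ι ℂ (Sum.inl 1)) 1
  | add (a b : A) : OmegaRel (FreeAlgebra.ι ℂ (Sum.inl (a + b)))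
      (FreeAlgebra.ι ℂ (Sum.inl a) + FreeAlgebra.ι ℂ (Sum.inl b))
  | smul (c : ℂ) (a : A) : OmegaRel (FreeAlgebra.ι ℂ (Sum.inl (c • a)))
      (c • FreeAlgebra.ι ℂ (Sum.inl a))
  | mul (a b : A) : OmegaRel (FreeAlgebra.ι ℂ (Sum.inl (a * b)))
      (FreeAlgebra.ι ℂ (Sum.inl a) * FreeAlgebra.ι ℂ (Sum.inl b))
  | d_add (a b : A) : OmegaRel (FreeAlgebra.ι ℂ (Sum.inr (a + b)))
      (FreeAlgebra.ι ℂ (Sum.inr a) + FreeAlgebra.ι ℂ (Sum.inr b))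
  | d_smul (c : ℂ) (a : A) : OmegaRel (FreeAlgebra.ι ℂ (Sum.inr (c • a)))
      (c • FreeAlgebra.ι ℂ (Sum.inr a))
  | d_mul (a b : A) : OmegaRel (FreeAlgebra.ι ℂ (Sum.inr (a * b)))
      (FreeAlgebra.ι ℂ (Sum.inr a) * FreeAlgebra.ι ℂ (Sum.inl b) +
        FreeAlgebra.ι ℂ (Sum.inl a) * FreeAlgebra.ι ℂ (Sum.inr b))

/-- The algebra underlying the universal differential calculus `Ω(A)`: it is generated by the
algebra `A` and symbols `da`, linear in `a ∈ A`, subject to `d(ab) = (da)b + a(db)`. -/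
def OmegaAlg : Type _ := RingQuot (OmegaRel A)

instance : Ring (OmegaAlg A) := inferInstanceAs (Ring (RingQuot (OmegaRel A)))

instance : Algebra ℂ (OmegaAlg A) := inferInstanceAs (Algebra ℂ (RingQuot (OmegaRel A)))

/-- The quotient map from the free algebra. -/
def omegaMk : FreeAlgebra ℂ (A ⊕ A) →ₐ[ℂ] OmegaAlg A := RingQuot.mkAlgHom ℂ (OmegaRel A)

variable {A}

/-- The generator `da` of `Ω(A)`. -/
def omegaD (a : A) : OmegaAlg A :=
  omegaMk A (FreeAlgebra.ι ℂ (Sum.inr a))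

theorem omega_rel {x y : FreeAlgebra ℂ (A ⊕ A)} (h : OmegaRel A x y) :
    omegaMk A x = omegaMk A y :=
  RingQuot.mkAlgHom_rel ℂ h

variable (A) in
/-- The inclusion `A → Ω(A)`. -/
def omegaOf : A →ₐ[ℂ] OmegaAlg A :=
  AlgHom.ofLinearMap
    { toFun := fun a => omegaMk A (FreeAlgebra.ι ℂ (Sum.inl a))
      map_add' := fun a b => by rw [omega_rel (OmegaRel.add a b), map_add]
      map_smul' := fun c a => by rw [omega_rel (OmegaRel.smul c a), map_smul]; rfl }
    ((omega_rel OmegaRel.one).trans (map_one _))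
    (fun a b => (omega_rel (OmegaRel.mul a b)).trans (map_mul _ _ _))

theorem omegaD_add (a b : A) : omegaD (a + b) = omegaD a + omegaD b :=
  (omega_rel (OmegaRel.d_add a b)).trans (map_add _ _ _)

theorem omegaD_smul (c : ℂ) (a : A) : omegaD (c • a) = c • omegaD a :=
  (omega_rel (OmegaRel.d_smul c a)).trans (map_smul _ _ _)

theorem omegaD_mul (a b : A) :
    omegaD (a * b) = omegaD a * omegaOf A b + omegaOf A a * omegaD b :=
  (omega_rel (OmegaRel.d_mul a b)).trans (by rw [map_add, map_mul, map_mul]; rfl)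

theorem omega_induction {p : OmegaAlg A → Prop} (x : OmegaAlg A)
    (of : ∀ a, p (omegaOf A a)) (d : ∀ a, p (omegaD a))
    (mul : ∀ x y, p x → p y → p (x * y)) (add : ∀ x y, p x → p y → p (x + y)) : p x := by
  obtain ⟨x, rfl⟩ : ∃ y, omegaMk A y = x := RingQuot.mkAlgHom_surjective ℂ (OmegaRel A) x
  induction x using FreeAlgebra.induction with
  | grade0 c =>
    rw [AlgHom.commutes, ← (omegaOf A).commutes]
    exact of _
  | grade1 x =>
    rcases x with a | a
    · exact of a
    · exact d a
  | mul x y hx hy => rw [map_mul]; exact mul _ _ hx hy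
  | add x y hx hy => rw [map_add]; exact add _ _ hx hy

variable {C : Type*} [Ring C] [Algebra ℂ C]

/-- Algebra homomorphisms out of `Ω(A)`. -/
def omegaLiftAlg (f : A →ₐ[ℂ] C) (g : A →ₗ[ℂ] C)
    (hg : ∀ a b, g (a * b) = g a * f b + f a * g b) : OmegaAlg A →ₐ[ℂ] C :=
  RingQuot.liftAlgHom ℂ ⟨FreeAlgebra.lift ℂ (Sum.elim f g), by
    intro x y h
    induction h <;> simp [hg]⟩

theorem omegaLiftAlg_of (f : A →ₐ[ℂ] C) (g : A →ₗ[ℂ] C)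
    (hg : ∀ a b, g (a * b) = g a * f b + f a * g b) (a : A) :
    omegaLiftAlg f g hg (omegaOf A a) = f a := by
  change RingQuot.liftAlgHom ℂ _ (RingQuot.mkAlgHom ℂ (OmegaRel A) _) = _
  rw [RingQuot.liftAlgHom_mkAlgHom_apply, FreeAlgebra.lift_ι_apply]
  rfl

theorem omegaLiftAlg_d (f : A →ₐ[ℂ] C) (g : A →ₗ[ℂ] C)
    (hg : ∀ a b, g (a * b) = g a * f b + f a * g b) (a : A) :
    omegaLiftAlg f g hg (omegaD a) = g a := by
  change RingQuot.liftAlgHom ℂ _ (RingQuot.mkAlgHom ℂ (OmegaRel A) _) = _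
  rw [RingQuot.liftAlgHom_mkAlgHom_apply, FreeAlgebra.lift_ι_apply]
  rfl

variable (A)

/-- `a ↦ da` as a linear map. -/
def omegaDLin : A →ₗ[ℂ] OmegaAlg A where
  toFun := omegaD
  map_add' := omegaD_add
  map_smul' := omegaD_smul

/-- The algebra homomorphism `Ω(A) → Ω(A)[T]` with `a ↦ a` and `da ↦ (da)T`, which counts the
number of factors `da`. -/
def omegaCount : OmegaAlg A →ₐ[ℂ] Polynomial (OmegaAlg A) :=
  omegaLiftAlg ((Polynomial.CAlgHom (R := ℂ) (A := OmegaAlg A)).comp (omegaOf A))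
    { toFun := fun a => Polynomial.monomial 1 (omegaD a)
      map_add' := fun a b => by rw [omegaD_add, map_add]
      map_smul' := fun c a => by rw [omegaD_smul, ← Polynomial.smul_monomial]; rfl }
    (fun a b => by
      change Polynomial.monomial 1 (omegaD (a * b)) =
        Polynomial.monomial 1 (omegaD a) * Polynomial.C (omegaOf A b) +
          Polynomial.C (omegaOf A a) * Polynomial.monomial 1 (omegaD b)
      rw [omegaD_mul, map_add, Polynomial.monomial_mul_C, Polynomial.C_mul_monomial])

/-- The component `Ωⁿ(A)`: the elements with exactly `n` factors `da`. -/
def omegaDeg (n : ℕ) : Submodule ℂ (OmegaAlg A) where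
  carrier := {x | omegaCount A x = Polynomial.monomial n x}
  add_mem' {x y} hx hy := by
    change omegaCount A (x + y) = _
    rw [map_add, map_add, hx, hy]
  zero_mem' := by
    change omegaCount A 0 = _
    rw [map_zero, map_zero]
  smul_mem' c x hx := by
    change omegaCount A (c • x) = _
    rw [map_smul, hx, Polynomial.smul_monomial]

variable {A}

theorem omegaDeg_iff {n : ℕ} {x : OmegaAlg A} :
    x ∈ omegaDeg A n ↔ omegaCount A x = Polynomial.monomial n x := Iff.rfl

theorem omegaOf_mem (a : A) : omegaOf A a ∈ omegaDeg A 0 := omegaLiftAlg_of _ _ _ a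

theorem omegaD_mem (a : A) : omegaD a ∈ omegaDeg A 1 := omegaLiftAlg_d _ _ _ a

theorem omega_mul_mem {m n : ℕ} {x y : OmegaAlg A} (hx : x ∈ omegaDeg A m)
    (hy : y ∈ omegaDeg A n) : x * y ∈ omegaDeg A (m + n) := by
  rw [omegaDeg_iff] at *
  rw [map_mul, hx, hy, Polynomial.monomial_mul_monomial]

theorem omega_iSup (S : ℕ → Submodule ℂ (OmegaAlg A)) (hof : ∀ a, omegaOf A a ∈ S 0)
    (hd : ∀ a, omegaD a ∈ S 1)
    (hmul : ∀ m n x y, x ∈ S m → y ∈ S n → x * y ∈ S (m + n)) : ⨆ n, S n = ⊤ := by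
  rw [eq_top_iff]
  rintro x -
  induction x using omega_induction with
  | of a => exact Submodule.mem_iSup_of_mem 0 (hof a)
  | d a => exact Submodule.mem_iSup_of_mem 1 (hd a)
  | mul x y hx hy =>
    induction hx using Submodule.iSup_induction' with
    | mem m x hx =>
      induction hy using Submodule.iSup_induction' with
      | mem n y hy => exact Submodule.mem_iSup_of_mem (m + n) (hmul _ _ _ _ hx hy)
      | zero => rw [mul_zero]; exact zero_mem _
      | add y z _ _ hy hz => rw [mul_add]; exact add_mem hy hz
    | zero => rw [zero_mul]; exact zero_mem _
    | add x z _ _ hx hz => rw [add_mul]; exact add_mem hx hz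
  | add x y hx hy => exact add_mem hx hy

theorem omega_internal : DirectSum.IsInternal (omegaDeg A) := by
  refine isInternal_of_proj _
    (fun n => (Polynomial.lcoeff (OmegaAlg A) n).restrictScalars ℂ ∘ₗ (omegaCount A).toLinearMap)
    ?_ (omega_iSup _ omegaOf_mem omegaD_mem fun _ _ _ _ => omega_mul_mem)
  intro m n x hx
  change (omegaCount A x).coeff m = _
  rw [omegaDeg_iff.mp hx, Polynomial.coeff_monomial]
  simp only [eq_comm]

/-- Induction on homogeneous elements of `Ω(A)`. -/
theorem omega_homog_induction {n : ℕ} {x : OmegaAlg A} (hx : x ∈ omegaDeg A n)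
    (T : ℕ → Submodule ℂ (OmegaAlg A)) (hof : ∀ a, omegaOf A a ∈ T 0) (hd : ∀ a, omegaD a ∈ T 1)
    (hmul : ∀ m n x y, x ∈ omegaDeg A m → y ∈ omegaDeg A n → x ∈ T m → y ∈ T n →
      x * y ∈ T (m + n)) : x ∈ T n := by
  have hS : ⨆ n, omegaDeg A n ⊓ T n = ⊤ :=
    omega_iSup _ (fun a => ⟨omegaOf_mem a, hof a⟩) (fun a => ⟨omegaD_mem a, hd a⟩)
      fun m n x y hx hy => ⟨omega_mul_mem hx.1 hy.1, hmul m n x y hx.1 hy.1 hx.2 hy.2⟩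
  have key : ∀ y : OmegaAlg A, ∀ k, (omegaCount A y).coeff k ∈ T k := by
    intro y k
    have hy : y ∈ ⨆ n, omegaDeg A n ⊓ T n := hS ▸ Submodule.mem_top
    induction hy using Submodule.iSup_induction' with
    | mem m y hy =>
      rw [omegaDeg_iff.mp hy.1, Polynomial.coeff_monomial]
      split_ifs with h
      · exact h ▸ hy.2
      · exact zero_mem _
    | zero => rw [map_zero]; exact zero_mem _
    | add y z _ _ hy hz => rw [map_add, Polynomial.coeff_add]; exact add_mem hy hz
  have h := key x n
  rwa [omegaDeg_iff.mp hx, Polynomial.coeff_monomial_same] at h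

variable (A)

/-- The algebra homomorphism `ω ↦ !![σ(ω), dω; 0, ω]`, where `σ(ω) = (-1)ⁿω` for `ω ∈ Ωⁿ(A)`. Its
multiplicativity expresses the graded Leibniz rule. -/
def omegaMat : OmegaAlg A →ₐ[ℂ] Matrix (Fin 2) (Fin 2) (OmegaAlg A) :=
  omegaLiftAlg
    (AlgHom.ofLinearMap
      { toFun := fun a => !![omegaOf A a, omegaD a; 0, omegaOf A a]
        map_add' := fun a b => by
          ext i j; fin_cases i <;> fin_cases j <;> simp [omegaD_add]
        map_smul' := fun c a => by
          ext i j; fin_cases i <;> fin_cases j <;> simp [omegaD_smul] }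
      (by
        have h : omegaD (1 : A) = 0 := by
          have := omegaD_mul (1 : A) 1
          simpa using this
        ext i j; fin_cases i <;> fin_cases j <;> simp [h])
      (fun a b => by
        ext i j; fin_cases i <;> fin_cases j <;>
          simp [Matrix.mul_apply, Fin.sum_univ_two, omegaD_mul, add_comm]))
    { toFun := fun a => !![-omegaD a, 0; 0, omegaD a]
      map_add' := fun a b => by
        ext i j; fin_cases i <;> fin_cases j <;> simp [omegaD_add, add_comm]
      map_smul' := fun c a => by
        ext i j; fin_cases i <;> fin_cases j <;> simp [omegaD_smul] }
    (fun a b => by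
      change !![-omegaD (a * b), 0; 0, omegaD (a * b)] =
        !![-omegaD a, 0; 0, omegaD a] * !![omegaOf A b, omegaD b; 0, omegaOf A b] +
          !![omegaOf A a, omegaD a; 0, omegaOf A a] * !![-omegaD b, 0; 0, omegaD b]
      rw [Matrix.mul_fin_two, Matrix.mul_fin_two, omegaD_mul]
      ext i j; fin_cases i <;> fin_cases j <;> simp [add_comm])

variable {A}

theorem omegaMat_of (a : A) :
    omegaMat A (omegaOf A a) = !![omegaOf A a, omegaD a; 0, omegaOf A a] :=
  omegaLiftAlg_of _ _ _ a

theorem omegaMat_d (a : A) : omegaMat A (omegaD a) = !![-omegaD a, 0; 0, omegaD a] :=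
  omegaLiftAlg_d _ _ _ a

theorem omegaMat_lower (x : OmegaAlg A) : omegaMat A x 1 0 = 0 ∧ omegaMat A x 1 1 = x := by
  induction x using omega_induction with
  | of a => rw [omegaMat_of]; simp
  | d a => rw [omegaMat_d]; simp
  | mul x y hx hy => simp [map_mul, Matrix.mul_apply, Fin.sum_univ_two, hx, hy]
  | add x y hx hy => simp [map_add, hx, hy]

theorem omegaMat_sign {n : ℕ} {x : OmegaAlg A} (hx : x ∈ omegaDeg A n) :
    omegaMat A x 0 0 = (-1 : ℂ) ^ n • x := by
  have key : ∀ y : OmegaAlg A, omegaMat A y 0 0 = (omegaCount A y).eval (-1) := by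
    intro y
    induction y using omega_induction with
    | of a => rw [omegaMat_of, omegaDeg_iff.mp (omegaOf_mem a)]; simp
    | d a => rw [omegaMat_d, omegaDeg_iff.mp (omegaD_mem a)]; simp
    | mul x y hx hy =>
      rw [map_mul, map_mul, Polynomial.eval, Polynomial.eval₂_mul_noncomm _ _
        fun k => Commute.neg_one_right ((omegaCount A y).coeff k)]
      rw [← Polynomial.eval, ← Polynomial.eval, ← hx, ← hy]
      simp [Matrix.mul_apply, Fin.sum_univ_two, omegaMat_lower]
    | add x y hx hy => rw [map_add, map_add, Polynomial.eval_add, ← hx, ← hy]; rfl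
  rw [key, omegaDeg_iff.mp hx, Polynomial.eval_monomial]
  rcases Nat.even_or_odd n with e | e <;> rw [e.neg_one_pow, e.neg_one_pow] <;> simp

variable (A) in
/-- The differential of `Ω(A)`. -/
def omegaDiff : OmegaAlg A →ₗ[ℂ] OmegaAlg A where
  toFun x := omegaMat A x 0 1
  map_add' x y := by rw [map_add]; rfl
  map_smul' c x := by rw [map_smul]; rfl

theorem omegaDiff_of (a : A) : omegaDiff A (omegaOf A a) = omegaD a := by
  change omegaMat A _ 0 1 = _
  rw [omegaMat_of]; rfl

theorem omegaDiff_d (a : A) : omegaDiff A (omegaD a) = 0 := by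
  change omegaMat A _ 0 1 = _
  rw [omegaMat_d]; rfl

theorem omegaDiff_mul {n : ℕ} {x : OmegaAlg A} (hx : x ∈ omegaDeg A n) (y : OmegaAlg A) :
    omegaDiff A (x * y) = omegaDiff A x * y + (-1 : ℂ) ^ n • (x * omegaDiff A y) := by
  change omegaMat A (x * y) 0 1 = omegaMat A x 0 1 * y + (-1 : ℂ) ^ n • (x * omegaMat A y 0 1)
  rw [map_mul, Matrix.mul_apply, Fin.sum_univ_two, omegaMat_sign hx, (omegaMat_lower y).2,
    smul_mul_assoc, add_comm]

theorem omegaDiff_mem {n : ℕ} {x : OmegaAlg A} (hx : x ∈ omegaDeg A n) :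
    omegaDiff A x ∈ omegaDeg A (n + 1) := by
  refine omega_homog_induction hx (fun n => (omegaDeg A (n + 1)).comap (omegaDiff A)) ?_ ?_ ?_
  · intro a
    rw [Submodule.mem_comap, omegaDiff_of]; exact omegaD_mem a
  · intro a
    rw [Submodule.mem_comap, omegaDiff_d]; exact zero_mem _
  · intro m n x y hx hy hx' hy'
    rw [Submodule.mem_comap] at *
    rw [omegaDiff_mul hx]
    refine add_mem ?_ (Submodule.smul_mem _ _ ?_)
    · rw [add_right_comm]; exact omega_mul_mem hx' hy
    · rw [add_assoc]; exact omega_mul_mem hx hy'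

theorem omegaDiff_sq (x : OmegaAlg A) : omegaDiff A (omegaDiff A x) = 0 := by
  have key : ∀ n, ∀ y ∈ omegaDeg A n, omegaDiff A (omegaDiff A y) = 0 := by
    intro n y hy
    refine omega_homog_induction hy (fun n => LinearMap.ker (omegaDiff A ∘ₗ omegaDiff A)) ?_ ?_ ?_
    · intro a
      rw [LinearMap.mem_ker, LinearMap.comp_apply, omegaDiff_of, omegaDiff_d]
    · intro a
      rw [LinearMap.mem_ker, LinearMap.comp_apply, omegaDiff_d, map_zero]
    · intro m n x y hx hy hx' hy'
      rw [LinearMap.mem_ker, LinearMap.comp_apply] at *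
      rw [omegaDiff_mul hx, map_add, map_smul, omegaDiff_mul (omegaDiff_mem hx), omegaDiff_mul hx,
        hx', hy', pow_succ, mul_neg_one, neg_smul, zero_mul, zero_add, mul_zero, smul_zero,
        add_zero, neg_add_cancel]
  have hx : x ∈ ⨆ n, omegaDeg A n :=
    (omega_internal (A := A)).submodule_iSup_eq_top ▸ Submodule.mem_top
  induction hx using Submodule.iSup_induction' with
  | mem m y hy => exact key m y hy
  | zero => rw [map_zero, map_zero]
  | add y z _ _ hy hz => rw [map_add, map_add, hy, hz, add_zero]

end Omega

/-- The universal differential calculus `Ω(A)`. -/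
def omega (A : Type*) [Ring A] [Algebra ℂ A] : DiffAlg where
  carrier := OmegaAlg A
  deg := omegaDeg A
  internal := omega_internal
  one_mem := by rw [← map_one (omegaOf A)]; exact omegaOf_mem 1
  mul_mem := omega_mul_mem
  d := omegaDiff A
  d_mem := omegaDiff_mem
  leibniz := omegaDiff_mul
  d_d := omegaDiff_sq

section OmegaMaps

/-- The inclusion `A → Ω(A)`, onto the component of degree zero. -/
def omegaIn (A : Type*) [Ring A] [Algebra ℂ A] : A →ₐ[ℂ] omega A := omegaOf A

variable {A : Type*} [Ring A] [Algebra ℂ A] {Γ : DiffAlg}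

/-- The algebra homomorphism `a ↦ f(a)`, `da ↦ d(f(a))`. -/
def omegaExt (f : A →ₐ[ℂ] Γ) (hf : ∀ a, f a ∈ Γ.deg 0) : OmegaAlg A →ₐ[ℂ] Γ :=
  omegaLiftAlg f (Γ.d ∘ₗ f.toLinearMap) fun a b => by
    change Γ.d (f (a * b)) = Γ.d (f a) * f b + f a * Γ.d (f b)
    rw [map_mul, Γ.leibniz (hf a), pow_zero, one_smul]

variable (f : A →ₐ[ℂ] Γ) (hf : ∀ a, f a ∈ Γ.deg 0)

theorem omegaExt_of (a : A) : omegaExt f hf (omegaOf A a) = f a := omegaLiftAlg_of _ _ _ a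

theorem omegaExt_d (a : A) : omegaExt f hf (omegaD a) = Γ.d (f a) := omegaLiftAlg_d _ _ _ a

theorem omegaExt_mem {n : ℕ} {x : OmegaAlg A} (hx : x ∈ omegaDeg A n) :
    omegaExt f hf x ∈ Γ.deg n := by
  refine omega_homog_induction hx (fun n => (Γ.deg n).comap (omegaExt f hf).toLinearMap) ?_ ?_ ?_
  · intro a
    rw [Submodule.mem_comap, AlgHom.toLinearMap_apply, omegaExt_of]; exact hf a
  · intro a
    rw [Submodule.mem_comap, AlgHom.toLinearMap_apply, omegaExt_d]; exact Γ.d_mem (hf a)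
  · intro m n x y _ _ hx hy
    rw [Submodule.mem_comap, AlgHom.toLinearMap_apply] at *
    rw [map_mul]
    exact Γ.mul_mem hx hy

theorem omegaExt_diff (x : OmegaAlg A) :
    omegaExt f hf (omegaDiff A x) = Γ.d (omegaExt f hf x) := by
  have key : ∀ n, ∀ y ∈ omegaDeg A n,
      omegaExt f hf (omegaDiff A y) = Γ.d (omegaExt f hf y) := by
    intro n y hy
    refine omega_homog_induction hy (fun n => LinearMap.eqLocus
      ((omegaExt f hf).toLinearMap ∘ₗ omegaDiff A) (Γ.d ∘ₗ (omegaExt f hf).toLinearMap)) ?_ ?_ ?_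
    · intro a
      change omegaExt f hf (omegaDiff A (omegaOf A a)) = Γ.d (omegaExt f hf (omegaOf A a))
      rw [omegaDiff_of, omegaExt_of, omegaExt_d]
    · intro a
      change omegaExt f hf (omegaDiff A (omegaD a)) = Γ.d (omegaExt f hf (omegaD a))
      rw [omegaDiff_d, omegaExt_d, map_zero, Γ.d_d]
    · intro m n x y hx hy h2 h4
      have h2 : omegaExt f hf (omegaDiff A x) = Γ.d (omegaExt f hf x) := h2
      have h4 : omegaExt f hf (omegaDiff A y) = Γ.d (omegaExt f hf y) := h4
      change omegaExt f hf (omegaDiff A (x * y)) = Γ.d (omegaExt f hf (x * y))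
      rw [omegaDiff_mul hx, map_add, map_mul, map_smul, map_mul, map_mul, h2, h4,
        Γ.leibniz (omegaExt_mem f hf hx)]
  have hx : x ∈ ⨆ n, omegaDeg A n :=
    (omega_internal (A := A)).submodule_iSup_eq_top ▸ Submodule.mem_top
  induction hx using Submodule.iSup_induction' with
  | mem m y hy => exact key m y hy
  | zero => rw [map_zero, map_zero, map_zero]
  | add y z _ _ hy hz => rw [map_add, map_add, hy, hz, map_add, map_add]

/-- The extension `Ω(A) → Γ` of an algebra homomorphism `f : A → Γ⁰` to a homomorphism of
differential algebras. -/
def omegaLift : Hom (omega A) Γ where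
  toAlgHom := omegaExt f hf
  map_deg := omegaExt_mem f hf
  map_d := omegaExt_diff f hf

theorem omegaLift_of (a : A) : omegaLift f hf (omegaIn A a) = f a := omegaExt_of f hf a

/-- A homomorphism of differential algebras on `Ω(A)` is determined by its values on `A`. -/
theorem omega_hom_ext {f g : Hom (omega A) Γ} (h : ∀ a, f (omegaIn A a) = g (omegaIn A a))
    (x : omega A) : f x = g x := by
  refine omega_induction (p := fun x => f x = g x) x h ?_ ?_ ?_
  · intro a
    rw [← omegaDiff_of]
    exact (f.comm_d _).trans ((congrArg Γ.d (h a)).trans (g.comm_d _).symm)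
  · intro x y hx hy
    change f.toAlgHom (show omega A from x) = g.toAlgHom (show omega A from x) at hx
    change f.toAlgHom (show omega A from y) = g.toAlgHom (show omega A from y) at hy
    change f.toAlgHom ((show omega A from x) * (show omega A from y)) =
      g.toAlgHom ((show omega A from x) * (show omega A from y))
    rw [map_mul, map_mul, hx, hy]
  · intro x y hx hy
    change f.toAlgHom (show omega A from x) = g.toAlgHom (show omega A from x) at hx
    change f.toAlgHom (show omega A from y) = g.toAlgHom (show omega A from y) at hy
    change f.toAlgHom ((show omega A from x) + (show omega A from y)) =
      g.toAlgHom ((show omega A from x) + (show omega A from y))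
    rw [map_add, map_add, hx, hy]

/-- The extension `Ω(A) → Ω(A')` of an algebra homomorphism `A → A'`. -/
def omegaMap {A' : Type*} [Ring A'] [Algebra ℂ A'] (f : A →ₐ[ℂ] A') : Hom (omega A) (omega A') :=
  omegaLift (Γ := omega A') ((omegaIn A').comp f) fun a => omegaOf_mem (f a)

theorem omegaMap_of {A' : Type*} [Ring A'] [Algebra ℂ A'] (f : A →ₐ[ℂ] A') (a : A) :
    omegaMap f (omegaIn A a) = omegaIn A' (f a) := omegaLift_of _ _ a

theorem omegaLift_surjective
    (h : Algebra.adjoin ℂ (Set.range f ∪ Set.range fun a => Γ.d (f a)) = ⊤) :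
    Function.Surjective (omegaLift f hf) := by
  rw [← AlgHom.range_eq_top, eq_top_iff, ← h, Algebra.adjoin_le_iff]
  rintro _ (⟨a, rfl⟩ | ⟨a, rfl⟩)
  · exact ⟨omegaIn A a, omegaLift_of f hf a⟩
  · refine ⟨(omega A).d (omegaIn A a), ((omegaLift f hf).comm_d _).trans ?_⟩
    rw [omegaLift_of]

theorem omega_generated :
    Algebra.adjoin ℂ (Set.range (omegaIn A) ∪ Set.range fun a => (omega A).d (omegaIn A a)) = ⊤ := by
  set S := Algebra.adjoin ℂ
    (Set.range (omegaIn A) ∪ Set.range fun a => (omega A).d (omegaIn A a)) with hS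
  rw [eq_top_iff]
  rintro x -
  refine omega_induction (p := fun x => (show omega A from x) ∈ S) x ?_ ?_ ?_ ?_
  · exact fun a => Algebra.subset_adjoin (Or.inl ⟨a, rfl⟩)
  · exact fun a => Algebra.subset_adjoin (Or.inr ⟨a, omegaDiff_of a⟩)
  · exact fun y z hy hz => S.mul_mem hy hz
  · exact fun y z hy hz => S.add_mem hy hz

theorem omegaMap_surjective {A' : Type*} [Ring A'] [Algebra ℂ A'] (f : A →ₐ[ℂ] A')
    (hf : Function.Surjective f) : Function.Surjective (omegaMap f) := by
  apply omegaLift_surjective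
  have h1 : Set.range ((omegaIn A').comp f) = Set.range (omegaIn A') := by
    rw [AlgHom.coe_comp, hf.range_comp]
  have h2 : (Set.range fun a => (omega A').d (((omegaIn A').comp f) a)) =
      Set.range fun a => (omega A').d (omegaIn A' a) :=
    hf.range_comp fun a => (omega A').d (omegaIn A' a)
  rw [h1, h2, omega_generated]

end OmegaMaps

end DiffAlg

namespace DiffAlg

/-! ### Differential algebras over an algebra -/

section Over

variable {A : Type*} [Ring A] [Algebra ℂ A]

/-- `Γ` is a differential algebra over `A`, where `A` is identified with `Γ⁰` by means of `of`. -/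
structure IsOver (Γ : DiffAlg) (of : A →ₐ[ℂ] Γ) : Prop where
  injective : Function.Injective of
  range_eq : ∀ x : Γ, x ∈ Γ.deg 0 ↔ x ∈ of.range

/-- `Γ` is a differential calculus over `A`: it is a differential algebra over `A` which is
generated, as an algebra over `A`, by the `da`, `a ∈ A`. -/
structure IsCalculus (Γ : DiffAlg) (of : A →ₐ[ℂ] Γ) : Prop extends IsOver Γ of where
  generated : Algebra.adjoin ℂ (Set.range of ∪ Set.range fun a => Γ.d (of a)) = ⊤

/-- The degree zero component `K⁰ = K ∩ A` of a differential ideal of a differential algebra over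
`A`. -/
def DiffIdeal.degZero {Γ : DiffAlg} (K : DiffIdeal Γ) (of : A →ₐ[ℂ] Γ) : Ideal A :=
  K.ideal.comap of

instance {Γ : DiffAlg} (K : DiffIdeal Γ) (of : A →ₐ[ℂ] Γ) : (K.degZero of).IsTwoSided :=
  inferInstanceAs (K.ideal.comap of).IsTwoSided

/-- The homomorphism `A/K⁰ → Γ/K` induced by the inclusion `A → Γ`. -/
def DiffIdeal.quotOf {Γ : DiffAlg} (K : DiffIdeal Γ) (of : A →ₐ[ℂ] Γ) :
    (A ⧸ K.degZero of) →ₐ[ℂ] K.quot :=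
  Ideal.Quotient.liftₐ (K.degZero of) (K.toQuot.toAlgHom.comp of) fun _ ha =>
    (K.toQuot_eq_zero _).mpr ha

/-- `Γ`, with the finite family `(Kᵢ)` of differential ideals, is an LC-differential algebra over
`A`: the `Kᵢ` form a covering of `Γ`, the factor differential algebras `Γ/Kᵢ` are differential
calculi over `A/Kᵢ⁰`, and `Kᵢ⁰ ≠ 0` for all `i`. -/
structure IsLC {I : Type*} (Γ : DiffAlg) (of : A →ₐ[ℂ] Γ) (K : I → DiffIdeal Γ) : Prop where
  isOver : IsOver Γ of
  covering : ⨅ i, (K i).ideal = ⊥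
  calculus : ∀ i, IsCalculus (K i).quot ((K i).quotOf of)
  degZero_ne_bot : ∀ i, (K i).degZero of ≠ ⊥

end Over

/-! ### Maps into skew tensor products -/

section SkewMaps

variable (Γ Λ : DiffAlg)

theorem d_one : Γ.d 1 = 0 := by
  have h := Γ.leibniz Γ.one_mem 1
  rw [mul_one, mul_one, one_mul, pow_zero, one_smul] at h
  exact left_eq_add.mp h

/-- The homomorphism `γ ↦ γ ⊗̂ 1`. -/
def skewInl : Hom Γ (skew Γ Λ) where
  toAlgHom := GradedTensorProduct.includeLeft Γ.deg Λ.deg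
  map_deg {n x} hx := by
    have h := stmul_mem hx Λ.one_mem
    rw [add_zero] at h
    exact h
  map_d x := by
    change stmul (Γ.d x) 1 = skewD Γ Λ (stmul x 1)
    induction x using Γ.hom_induction with
    | hom n x hx => rw [skewD_stmul Γ Λ hx, Λ.d_one, stmul_zero, smul_zero, add_zero]
    | zero => rw [map_zero, zero_stmul, map_zero]
    | add y z hy hz => rw [map_add, add_stmul, add_stmul, map_add, hy, hz]

/-- The homomorphism `ρ ↦ 1 ⊗̂ ρ`. -/
def skewInr : Hom Λ (skew Γ Λ) where
  toAlgHom := GradedTensorProduct.includeRight Γ.deg Λ.deg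
  map_deg {n x} hx := by
    have h := stmul_mem Γ.one_mem hx
    rw [zero_add] at h
    exact h
  map_d x := by
    change stmul 1 (Λ.d x) = skewD Γ Λ (stmul 1 x)
    rw [skewD_stmul Γ Λ Γ.one_mem, Γ.d_one, zero_stmul, zero_add, pow_zero, one_smul]

theorem skewInl_mul_skewInr (x : Γ) (y : Λ) :
    skewInl Γ Λ x * skewInr Γ Λ y = (show skew Γ Λ from stmul x y) :=
  GradedTensorProduct.tmul_one_mul_one_tmul (R := ℂ) Γ.deg Λ.deg x y

variable {Γ Λ} {A H : Type*} [Ring A] [Algebra ℂ A] [Ring H] [Algebra ℂ H]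
  (f : A →ₐ[ℂ] Γ) (g : H →ₐ[ℂ] Λ) (hf : ∀ a, f a ∈ Γ.deg 0) (hg : ∀ h, g h ∈ Λ.deg 0)

/-- The homomorphism `A ⊗ H → Γ ⊗̂ Λ`, `a ⊗ h ↦ f(a) ⊗̂ g(h)`, for homomorphisms `f : A → Γ⁰` and
`g : H → Λ⁰`. -/
def skewOf : A ⊗[ℂ] H →ₐ[ℂ] skew Γ Λ :=
  Algebra.TensorProduct.lift ((skewInl Γ Λ).toAlgHom.comp f) ((skewInr Γ Λ).toAlgHom.comp g)
    fun a h => by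
      change skewInl Γ Λ (f a) * skewInr Γ Λ (g h) = skewInr Γ Λ (g h) * skewInl Γ Λ (f a)
      rw [skewInl_mul_skewInr]
      refine Eq.symm ((stmul_mul Γ Λ 1 1 (hg h) (hf a)).trans ?_)
      rw [one_mul, mul_one, mul_zero, pow_zero, one_smul]

theorem skewOf_inl (a : A) : skewOf f g hf hg (a ⊗ₜ 1) = skewInl Γ Λ (f a) := by
  rw [skewOf, Algebra.TensorProduct.lift_tmul, map_one, mul_one]; rfl

theorem skewOf_inr (h : H) : skewOf f g hf hg (1 ⊗ₜ h) = skewInr Γ Λ (g h) := by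
  rw [skewOf, Algebra.TensorProduct.lift_tmul, map_one, one_mul]; rfl

theorem skewOf_mem (x : A ⊗[ℂ] H) : skewOf f g hf hg x ∈ (skew Γ Λ).deg 0 := by
  induction x using TensorProduct.induction_on with
  | zero => rw [map_zero]; exact zero_mem _
  | tmul a h =>
    rw [skewOf, Algebra.TensorProduct.lift_tmul]
    have h := (skew Γ Λ).mul_mem ((skewInl Γ Λ).map_mem (hf a)) ((skewInr Γ Λ).map_mem (hg h))
    rw [add_zero] at h
    exact h
  | add x y hx hy => rw [map_add]; exact add_mem hx hy

/-- The skew tensor product of differential calculi is generated in degree zero. -/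
theorem skew_generated
    (hΓ : Algebra.adjoin ℂ (Set.range f ∪ Set.range fun a => Γ.d (f a)) = ⊤)
    (hΛ : Algebra.adjoin ℂ (Set.range g ∪ Set.range fun a => Λ.d (g a)) = ⊤) :
    Algebra.adjoin ℂ (Set.range (skewOf f g hf hg) ∪
      Set.range fun x => (skew Γ Λ).d (skewOf f g hf hg x)) = ⊤ := by
  set S := Algebra.adjoin ℂ (Set.range (skewOf f g hf hg) ∪
      Set.range fun x => (skew Γ Λ).d (skewOf f g hf hg x)) with hS
  have h1 : ∀ x, skewOf f g hf hg x ∈ S := fun x => Algebra.subset_adjoin (Or.inl ⟨x, rfl⟩)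
  have h2 : ∀ x, (skew Γ Λ).d (skewOf f g hf hg x) ∈ S :=
    fun x => Algebra.subset_adjoin (Or.inr ⟨x, rfl⟩)
  have hl : ∀ x : Γ, skewInl Γ Λ x ∈ S := by
    have : (⊤ : Subalgebra ℂ Γ) ≤ S.comap (skewInl Γ Λ).toAlgHom := by
      rw [← hΓ, Algebra.adjoin_le_iff]
      rintro _ (⟨a, rfl⟩ | ⟨a, rfl⟩)
      · change skewInl Γ Λ (f a) ∈ S
        rw [← skewOf_inl f g hf hg]; exact h1 _
      · change skewInl Γ Λ (Γ.d (f a)) ∈ S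
        rw [Hom.comm_d, ← skewOf_inl f g hf hg]; exact h2 _
    exact fun x => this Algebra.mem_top
  have hr : ∀ x : Λ, skewInr Γ Λ x ∈ S := by
    have : (⊤ : Subalgebra ℂ Λ) ≤ S.comap (skewInr Γ Λ).toAlgHom := by
      rw [← hΛ, Algebra.adjoin_le_iff]
      rintro _ (⟨a, rfl⟩ | ⟨a, rfl⟩)
      · change skewInr Γ Λ (g a) ∈ S
        rw [← skewOf_inr f g hf hg]; exact h1 _
      · change skewInr Γ Λ (Λ.d (g a)) ∈ S
        rw [Hom.comm_d, ← skewOf_inr f g hf hg]; exact h2 _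
    exact fun x => this Algebra.mem_top
  rw [eq_top_iff]
  rintro (x : SkewTensor Γ Λ) -
  induction x using skew_induction with
  | hom m n a _ b _ =>
    have h := S.mul_mem (hl a) (hr b)
    rw [skewInl_mul_skewInr] at h
    exact h
  | zero => exact S.zero_mem
  | add y z hy hz => exact S.add_mem hy hz

end SkewMaps

end DiffAlg

/-- A differential calculus over the algebra `A`. -/
structure Calculus (A : Type*) [Ring A] [Algebra ℂ A] extends DiffAlg where
  of : A →ₐ[ℂ] carrier
  isCalculus : DiffAlg.IsCalculus toDiffAlg of

theorem Calculus.of_mem {A : Type*} [Ring A] [Algebra ℂ A] (Γ : Calculus A) (a : A) :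
    Γ.of a ∈ Γ.deg 0 := (Γ.isCalculus.range_eq _).mpr ⟨a, rfl⟩

/-- The projection `Ω(A) → Γ(A)`, i.e. `id_{Ω → Γ}`. -/
def Calculus.ofOmega {A : Type*} [Ring A] [Algebra ℂ A] (Γ : Calculus A) :
    DiffAlg.Hom (DiffAlg.omega A) Γ.toDiffAlg := DiffAlg.omegaLift Γ.of Γ.of_mem

theorem Calculus.ofOmega_surjective {A : Type*} [Ring A] [Algebra ℂ A] (Γ : Calculus A) :
    Function.Surjective Γ.ofOmega := DiffAlg.omegaLift_surjective _ _ Γ.isCalculus.generated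

/-- A differential calculus `Γ(H)` over a Hopf algebra `H` is right covariant if there is a right
coaction `Δ^Γ : Γ(H) → Γ(H) ⊗ H` making it a right `H`-comodule algebra such that
`Δ^Γ(h₀ dh₁ ⋯ dhₙ) = Δ(h₀) (d ⊗ id)Δ(h₁) ⋯ (d ⊗ id)Δ(hₙ)`. -/
def Calculus.IsRightCovariant {H : Type*} [Ring H] [HopfAlgebra ℂ H] (Γ : Calculus H) : Prop :=
  ∃ δ : Γ.carrier →ₐ[ℂ] Γ.carrier ⊗[ℂ] H,
    ((Algebra.TensorProduct.assoc ℂ ℂ ℂ Γ.carrier H H).toAlgHom.comp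
        (Algebra.TensorProduct.map δ (AlgHom.id ℂ H))).comp δ =
      (Algebra.TensorProduct.map (AlgHom.id ℂ Γ.carrier) (Bialgebra.comulAlgHom ℂ H)).comp δ ∧
    ((Algebra.TensorProduct.rid ℂ ℂ Γ.carrier).toAlgHom.comp
        (Algebra.TensorProduct.map (AlgHom.id ℂ Γ.carrier) (Bialgebra.counitAlgHom ℂ H))).comp δ =
      AlgHom.id ℂ Γ.carrier ∧
    ∀ (h₀ : H) (l : List H),
      δ (Γ.of h₀ * (l.map fun h => Γ.d (Γ.of h)).prod) =
        TensorProduct.map Γ.of.toLinearMap LinearMap.id (Coalgebra.comul (R := ℂ) h₀) *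
          (l.map fun h => TensorProduct.map (Γ.d ∘ₗ Γ.of.toLinearMap) LinearMap.id
            (Coalgebra.comul (R := ℂ) h)).prod

/-- A finite family of ideals `(Jᵢ)` of the algebra `A` is a complete covering if `⋂ᵢ Jᵢ = 0` and
the canonical embedding `a ↦ (a + Jᵢ)ᵢ` of `A` into the covering completion
`{(bᵢ) ∈ ⨁ᵢ A/Jᵢ | bᵢ = bⱼ in A/(Jᵢ + Jⱼ)}` is surjective. -/
structure IsCompleteCovering {I A : Type*} [Ring A] (J : I → Ideal A) : Prop where
  iInf_eq_bot : ⨅ i, J i = ⊥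
  complete : ∀ b : ∀ i, A ⧸ J i,
    (∀ i j, Submodule.factor (le_sup_left : J i ≤ J i ⊔ J j) (b i) =
      Submodule.factor (le_sup_right : J j ≤ J i ⊔ J j) (b j)) →
    ∃ a : A, ∀ i, b i = Submodule.Quotient.mk a

/-- A locally trivial quantum principal fibre bundle with base algebra `B` covered by the ideals
`J i`, structure Hopf algebra `H` and total space algebra `P`. -/
structure QPFB {I : Type*} (B H P : Type*) [Ring B] [Algebra ℂ B] [Ring H] [HopfAlgebra ℂ H]
    [Ring P] [Algebra ℂ P] (J : I → Ideal B) [∀ i, (J i).IsTwoSided] where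
  /-- the right coaction `Δ_P` of `H` on `P` -/
  coaction : P →ₐ[ℂ] P ⊗[ℂ] H
  coassoc : ((Algebra.TensorProduct.assoc ℂ ℂ ℂ P H H).toAlgHom.comp
      (Algebra.TensorProduct.map coaction (AlgHom.id ℂ H))).comp coaction =
    (Algebra.TensorProduct.map (AlgHom.id ℂ P) (Bialgebra.comulAlgHom ℂ H)).comp coaction
  counit : ((Algebra.TensorProduct.rid ℂ ℂ P).toAlgHom.comp
      (Algebra.TensorProduct.map (AlgHom.id ℂ P) (Bialgebra.counitAlgHom ℂ H))).comp coaction =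
    AlgHom.id ℂ P
  /-- the local trivializations -/
  χ : ∀ i, P →ₐ[ℂ] (B ⧸ J i) ⊗[ℂ] H
  /-- the embedding of the base algebra -/
  ι : B →ₐ[ℂ] P
  χ_surjective : ∀ i, Function.Surjective (χ i)
  ι_injective : Function.Injective ι
  χ_coaction : ∀ i,
    (Algebra.TensorProduct.map (AlgHom.id ℂ (B ⧸ J i)) (Bialgebra.comulAlgHom ℂ H)).comp (χ i) =
      ((Algebra.TensorProduct.assoc ℂ ℂ ℂ (B ⧸ J i) H H).toAlgHom.comp
        (Algebra.TensorProduct.map (χ i) (AlgHom.id ℂ H))).comp coaction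
  χ_ι : ∀ i a, χ i (ι a) = Ideal.Quotient.mk (J i) a ⊗ₜ 1
  base_covering : IsCompleteCovering J
  total_covering : IsCompleteCovering fun i => RingHom.ker (χ i)
  range_ι : ∀ f, f ∈ ι.range ↔ coaction f = f ⊗ₜ 1

namespace QPFB

open DiffAlg

variable {I : Type*} {B H P : Type*} [Ring B] [Algebra ℂ B] [Ring H] [HopfAlgebra ℂ H]
  [Ring P] [Algebra ℂ P] {J : I → Ideal B} [∀ i, (J i).IsTwoSided] (E : QPFB B H P J)
  (Γ : ∀ i, Calculus (B ⧸ J i)) (ΓH : Calculus H)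

/-! ### The differential structure on the bundle -/

/-- The differential calculus `Γ(Bᵢ) ⊗̂ Γ(H)` over `Bᵢ ⊗ H`. -/
def trivCalc (_ : QPFB B H P J) (i : I) : DiffAlg := skew (Γ i).toDiffAlg ΓH.toDiffAlg

/-- The inclusion `Bᵢ ⊗ H → Γ(Bᵢ) ⊗̂ Γ(H)`. -/
def trivOf (i : I) : (B ⧸ J i) ⊗[ℂ] H →ₐ[ℂ] E.trivCalc Γ ΓH i :=
  skewOf (Γ i).of ΓH.of (Γ i).of_mem ΓH.of_mem

theorem trivOf_mem (i : I) (x : (B ⧸ J i) ⊗[ℂ] H) :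
    E.trivOf Γ ΓH i x ∈ (E.trivCalc Γ ΓH i).deg 0 :=
  skewOf_mem _ _ _ _ x

/-- The homomorphism `γ ↦ γ ⊗̂ 1` from `Γ(Bᵢ)` to `Γ(Bᵢ) ⊗̂ Γ(H)`. -/
def trivInl (i : I) : Hom (Γ i).toDiffAlg (E.trivCalc Γ ΓH i) := skewInl _ _

theorem trivOf_inl (i : I) (b : B ⧸ J i) :
    E.trivOf Γ ΓH i (b ⊗ₜ 1) = E.trivInl Γ ΓH i ((Γ i).of b) := skewOf_inl _ _ _ _ b

/-- The extension `χᵢ_{Ω → Γ} : Ω(P) → Γ(Bᵢ) ⊗̂ Γ(H)` of `χᵢ`. -/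
def χΩ (i : I) : Hom (omega P) (E.trivCalc Γ ΓH i) :=
  omegaLift ((E.trivOf Γ ΓH i).comp (E.χ i)) fun p => E.trivOf_mem Γ ΓH i (E.χ i p)

/-- The differential ideal `J(P) = ⋂ᵢ ker χᵢ_{Ω → Γ}`. -/
def idealP : DiffIdeal (omega P) := DiffIdeal.inf fun i => DiffIdeal.ker (E.χΩ Γ ΓH i)

/-- The differential structure `Γ(P) = Ω(P)/J(P)` on the bundle determined by the differential
calculi `Γ(Bᵢ)` and `Γ(H)`. -/
def ΓP : DiffAlg := (E.idealP Γ ΓH).quot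

/-- The projection `Ω(P) → Γ(P)`. -/
def toΓP : Hom (omega P) (E.ΓP Γ ΓH) := (E.idealP Γ ΓH).toQuot

/-- The inclusion `P → Γ(P)`. -/
def ofP : P →ₐ[ℂ] E.ΓP Γ ΓH := (E.toΓP Γ ΓH).toAlgHom.comp (omegaIn P)

/-- The extension `χᵢ_Γ : Γ(P) → Γ(Bᵢ) ⊗̂ Γ(H)` of `χᵢ`. -/
def χΓ (i : I) : Hom (E.ΓP Γ ΓH) (E.trivCalc Γ ΓH i) :=
  (E.idealP Γ ΓH).lift (E.χΩ Γ ΓH i) fun _ hx => (Submodule.mem_iInf _).mp hx i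

theorem χΓ_ofP (i : I) (p : P) : E.χΓ Γ ΓH i (E.ofP Γ ΓH p) = E.trivOf Γ ΓH i (E.χ i p) :=
  omegaLift_of _ _ p

theorem χΓ_surjective (i : I) : Function.Surjective (E.χΓ Γ ΓH i) := by
  have h : Function.Surjective (E.χΩ Γ ΓH i) := by
    apply omegaLift_surjective
    have hr : Set.range ((E.trivOf Γ ΓH i).comp (E.χ i)) = Set.range (E.trivOf Γ ΓH i) := by
      rw [AlgHom.coe_comp, (E.χ_surjective i).range_comp]
    have hr' : (Set.range fun p => (E.trivCalc Γ ΓH i).d (((E.trivOf Γ ΓH i).comp (E.χ i)) p)) =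
        Set.range fun x => (E.trivCalc Γ ΓH i).d (E.trivOf Γ ΓH i x) :=
      (E.χ_surjective i).range_comp fun x => (E.trivCalc Γ ΓH i).d (E.trivOf Γ ΓH i x)
    rw [hr, hr']
    exact skew_generated _ _ _ _ (Γ i).isCalculus.generated ΓH.isCalculus.generated
  intro y
  obtain ⟨x, rfl⟩ := h y
  exact ⟨(E.idealP Γ ΓH).toQuot x, rfl⟩

section Completion

variable [Finite I]

/-- The covering completion `Γ_c(P)` of `Γ(P)` with respect to the covering `(ker χᵢ_Γ)ᵢ`. -/
def ΓcP : DiffAlg := completion (E.ΓP Γ ΓH) fun i => DiffIdeal.ker (E.χΓ Γ ΓH i)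

/-- The canonical homomorphism `P → Γ_c(P)`. -/
def ofPc : P →ₐ[ℂ] E.ΓcP Γ ΓH :=
  (toCompletion (E.ΓP Γ ΓH) fun i => DiffIdeal.ker (E.χΓ Γ ΓH i)).toAlgHom.comp (E.ofP Γ ΓH)

/-- The extension `χᵢ_{Γ_c} : Γ_c(P) → Γ(Bᵢ) ⊗̂ Γ(H)` of `χᵢ`: the `i`-th projection, followed by
the isomorphism `Γ(P)/ker χᵢ_Γ ≅ Γ(Bᵢ) ⊗̂ Γ(H)` induced by `χᵢ_Γ`. -/
def χΓc (i : I) : Hom (E.ΓcP Γ ΓH) (E.trivCalc Γ ΓH i) :=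
  ((DiffIdeal.ker (E.χΓ Γ ΓH i)).lift (E.χΓ Γ ΓH i) fun _ hx => hx).comp
    (completionProj (E.ΓP Γ ΓH) (fun i => DiffIdeal.ker (E.χΓ Γ ΓH i)) i)

end Completion

/-! ### The overlap calculi and `Γ_m(B)` -/

instance (i j : I) : (J i ⊔ J j).IsTwoSided := DiffIdeal.sup_isTwoSided _ _

/-- The ideal `χᵢ_Γ(ker χⱼ_Γ)` of `Γ(Bᵢ) ⊗̂ Γ(H)`. -/
def overlapIdeal (i j : I) : DiffIdeal (E.trivCalc Γ ΓH i) :=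
  (DiffIdeal.ker (E.χΓ Γ ΓH j)).map (E.χΓ Γ ΓH i) (E.χΓ_surjective Γ ΓH i)

/-- The differential calculus `Γⁱ(Bᵢⱼ ⊗ H) = (Γ(Bᵢ) ⊗̂ Γ(H))/χᵢ_Γ(ker χⱼ_Γ)`. -/
def overlapCalc (i j : I) : DiffAlg := (E.overlapIdeal Γ ΓH i j).quot

/-- The projection `Γ(Bᵢ) ⊗̂ Γ(H) → Γⁱ(Bᵢⱼ ⊗ H)`. -/
def toOverlap (i j : I) : Hom (E.trivCalc Γ ΓH i) (E.overlapCalc Γ ΓH i j) :=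
  (E.overlapIdeal Γ ΓH i j).toQuot

theorem toOverlap_χΓ (i j : I) (x : E.ΓP Γ ΓH) (hx : E.χΓ Γ ΓH j x = 0) :
    E.toOverlap Γ ΓH i j (E.χΓ Γ ΓH i x) = 0 :=
  (DiffIdeal.toQuot_eq_zero _ _).mpr (Ideal.mem_map_of_mem (E.χΓ Γ ΓH i).toAlgHom hx)

theorem overlap_vanish (i j : I) {b : B} (hb : b ∈ J i ⊔ J j) :
    E.toOverlap Γ ΓH i j
      (E.trivOf Γ ΓH i (Ideal.Quotient.mk (J i) b ⊗ₜ 1)) = 0 := by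
  obtain ⟨x, hx, y, hy, rfl⟩ := Submodule.mem_sup.mp hb
  have hx' : Ideal.Quotient.mk (J i) x = 0 := Ideal.Quotient.eq_zero_iff_mem.mpr hx
  have hy' : Ideal.Quotient.mk (J j) y = 0 := Ideal.Quotient.eq_zero_iff_mem.mpr hy
  rw [map_add, hx', zero_add, ← E.χ_ι, ← E.χΓ_ofP]
  apply E.toOverlap_χΓ
  rw [E.χΓ_ofP, E.χ_ι, hy', TensorProduct.zero_tmul, map_zero]

/-- The canonical homomorphism `Bᵢⱼ → Γⁱ(Bᵢⱼ ⊗ H)`, `b + Jᵢ + Jⱼ ↦ [(b + Jᵢ) ⊗̂ 1]`. -/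
def overlapInl (i j : I) : (B ⧸ (J i ⊔ J j)) →ₐ[ℂ] E.overlapCalc Γ ΓH i j :=
  Ideal.Quotient.liftₐ (J i ⊔ J j)
    (((E.toOverlap Γ ΓH i j).toAlgHom.comp (E.trivOf Γ ΓH i)).comp
      (Algebra.TensorProduct.includeLeft.comp (Ideal.Quotient.mkₐ ℂ (J i))))
    fun _ hb => E.overlap_vanish Γ ΓH i j hb

/-- The canonical homomorphism `H → Γⁱ(Bᵢⱼ ⊗ H)`, `h ↦ [1 ⊗̂ h]`. -/
def overlapInr (i j : I) : H →ₐ[ℂ] E.overlapCalc Γ ΓH i j :=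
  ((E.toOverlap Γ ΓH i j).toAlgHom.comp (E.trivOf Γ ΓH i)).comp
    Algebra.TensorProduct.includeRight

/-- The canonical homomorphism `Bᵢⱼ ⊗ H → Γⁱ(Bᵢⱼ ⊗ H)`, `πᵢⱼ(b) ⊗ h ↦ [πᵢ(b) ⊗̂ h]`. -/
def overlapOf (i j : I) : (B ⧸ (J i ⊔ J j)) ⊗[ℂ] H →ₐ[ℂ] E.overlapCalc Γ ΓH i j :=
  Algebra.TensorProduct.lift (E.overlapInl Γ ΓH i j) (E.overlapInr Γ ΓH i j) fun b h => by
    obtain ⟨b, rfl⟩ := Ideal.Quotient.mk_surjective b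
    let F := (E.toOverlap Γ ΓH i j).toAlgHom.comp (E.trivOf Γ ΓH i)
    change F (Ideal.Quotient.mk (J i) b ⊗ₜ 1) * F (1 ⊗ₜ h) =
      F (1 ⊗ₜ h) * F (Ideal.Quotient.mk (J i) b ⊗ₜ 1)
    rw [← map_mul, ← map_mul, Algebra.TensorProduct.tmul_mul_tmul,
      Algebra.TensorProduct.tmul_mul_tmul, one_mul, one_mul, mul_one, mul_one]

theorem overlapOf_tmul (i j : I) (b : B) (h : H) :
    E.overlapOf Γ ΓH i j (Ideal.Quotient.mk (J i ⊔ J j) b ⊗ₜ h) =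
      E.toOverlap Γ ΓH i j
        (E.trivOf Γ ΓH i (Ideal.Quotient.mk (J i) b ⊗ₜ h)) := by
  rw [overlapOf, Algebra.TensorProduct.lift_tmul]
  let F := (E.toOverlap Γ ΓH i j).toAlgHom.comp (E.trivOf Γ ΓH i)
  change F (Ideal.Quotient.mk (J i) b ⊗ₜ 1) * F (1 ⊗ₜ h) = F (Ideal.Quotient.mk (J i) b ⊗ₜ h)
  rw [← map_mul, Algebra.TensorProduct.tmul_mul_tmul, one_mul, mul_one]

theorem overlapOf_mem (i j : I) (x : (B ⧸ (J i ⊔ J j)) ⊗[ℂ] H) :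
    E.overlapOf Γ ΓH i j x ∈ (E.overlapCalc Γ ΓH i j).deg 0 := by
  induction x using TensorProduct.induction_on with
  | zero => rw [map_zero]; exact zero_mem _
  | tmul b h =>
    obtain ⟨b, rfl⟩ := Ideal.Quotient.mk_surjective b
    rw [overlapOf_tmul]
    exact Hom.map_mem _ (E.trivOf_mem Γ ΓH i _)
  | add x y hx hy => rw [map_add]; exact add_mem hx hy

/-- The differential ideal `Jⁱ(Bᵢⱼ ⊗ H) ⊂ Ω(Bᵢⱼ ⊗ H)` corresponding to the differential calculus
`Γⁱ(Bᵢⱼ ⊗ H)`. -/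
def idealBijH (i j : I) : DiffIdeal (omega ((B ⧸ (J i ⊔ J j)) ⊗[ℂ] H)) :=
  DiffIdeal.ker (omegaLift (E.overlapOf Γ ΓH i j) (E.overlapOf_mem Γ ΓH i j))

/-- The differential ideal `J_m(Bᵢⱼ) = Jⁱ(Bᵢⱼ) = Jⁱ(Bᵢⱼ ⊗ H) ∩ Ω(Bᵢⱼ ⊗ 1)` of `Ω(Bᵢⱼ)`. -/
def idealBij (i j : I) : DiffIdeal (omega (B ⧸ (J i ⊔ J j))) :=
  (E.idealBijH Γ ΓH i j).comap (omegaMap Algebra.TensorProduct.includeLeft)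

/-- The differential calculus `Γ_m(Bᵢⱼ) = Ω(Bᵢⱼ)/J_m(Bᵢⱼ)`. -/
def ΓmBij (i j : I) : DiffAlg := (E.idealBij Γ ΓH i j).quot

/-- The projection `Ω(Bᵢⱼ) → Γ_m(Bᵢⱼ)`. -/
def toΓmBij (i j : I) : Hom (omega (B ⧸ (J i ⊔ J j))) (E.ΓmBij Γ ΓH i j) :=
  (E.idealBij Γ ΓH i j).toQuot

/-- The projection `πⁱⱼ : Bᵢ → Bᵢⱼ`. -/
def πl (_ : QPFB B H P J) (i j : I) : (B ⧸ J i) →ₐ[ℂ] (B ⧸ (J i ⊔ J j)) :=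
  Ideal.Quotient.liftₐ (J i) (Ideal.Quotient.mkₐ ℂ (J i ⊔ J j)) fun _ hb =>
    Ideal.Quotient.eq_zero_iff_mem.mpr (Ideal.mem_sup_left hb)

/-- The projection `πʲᵢ : Bⱼ → Bᵢⱼ`. -/
def πr (_ : QPFB B H P J) (i j : I) : (B ⧸ J j) →ₐ[ℂ] (B ⧸ (J i ⊔ J j)) :=
  Ideal.Quotient.liftₐ (J j) (Ideal.Quotient.mkₐ ℂ (J i ⊔ J j)) fun _ hb =>
    Ideal.Quotient.eq_zero_iff_mem.mpr (Ideal.mem_sup_right hb)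

/-- The composition `Ω(Bᵢⱼ) → Ω(Bᵢⱼ ⊗ H) → Γⁱ(Bᵢⱼ ⊗ H)`, with kernel `J_m(Bᵢⱼ)`. -/
def overlapΩ (i j : I) : Hom (omega (B ⧸ (J i ⊔ J j))) (E.overlapCalc Γ ΓH i j) :=
  (omegaLift (E.overlapOf Γ ΓH i j) (E.overlapOf_mem Γ ΓH i j)).comp
    (omegaMap Algebra.TensorProduct.includeLeft)

theorem overlapΩ_of (i j : I) (b : B) :
    E.overlapΩ Γ ΓH i j (omegaIn _ (Ideal.Quotient.mk (J i ⊔ J j) b)) =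
      E.toOverlap Γ ΓH i j
        (E.trivOf Γ ΓH i (Ideal.Quotient.mk (J i) b ⊗ₜ 1)) := by
  rw [overlapΩ, Hom.comp_apply, omegaMap_of, omegaLift_of]
  exact E.overlapOf_tmul Γ ΓH i j b 1

theorem πmL_aux (i j : I) (x : omega (B ⧸ J i)) (hx : (Γ i).ofOmega x = 0) :
    ((E.toΓmBij Γ ΓH i j).comp (omegaMap (E.πl i j))) x = 0 := by
  refine (DiffIdeal.toQuot_eq_zero _ _).mpr ?_
  change (E.overlapΩ Γ ΓH i j).comp (omegaMap (E.πl i j)) x = 0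
  have key := omega_hom_ext (f := (E.overlapΩ Γ ΓH i j).comp (omegaMap (E.πl i j)))
    (g := (E.toOverlap Γ ΓH i j).comp ((E.trivInl Γ ΓH i).comp (Γ i).ofOmega))
    (fun b => by
      obtain ⟨b, rfl⟩ := Ideal.Quotient.mk_surjective b
      rw [Hom.comp_apply, omegaMap_of]
      refine (E.overlapΩ_of Γ ΓH i j b).trans ?_
      rw [E.trivOf_inl, Hom.comp_apply, Hom.comp_apply, Calculus.ofOmega, omegaLift_of]) x
  rw [key, Hom.comp_apply, Hom.comp_apply, hx, map_zero, map_zero]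

theorem πmR_aux (i j : I) (x : omega (B ⧸ J j)) (hx : (Γ j).ofOmega x = 0) :
    ((E.toΓmBij Γ ΓH i j).comp (omegaMap (E.πr i j))) x = 0 := by
  refine (DiffIdeal.toQuot_eq_zero _ _).mpr ?_
  change (E.overlapΩ Γ ΓH i j).comp (omegaMap (E.πr i j)) x = 0
  obtain ⟨y, rfl⟩ := omegaMap_surjective _ (Ideal.Quotient.mkₐ_surjective ℂ (J j)) x
  let z : E.ΓP Γ ΓH := E.toΓP Γ ΓH (omegaMap E.ι y)
  have h1 : E.χΓ Γ ΓH j z = 0 := by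
    have key := omega_hom_ext
      (f := (E.χΓ Γ ΓH j).comp ((E.toΓP Γ ΓH).comp (omegaMap E.ι)))
      (g := (E.trivInl Γ ΓH j).comp
        ((Γ j).ofOmega.comp (omegaMap (Ideal.Quotient.mkₐ ℂ (J j)))))
      (fun b => by
        rw [Hom.comp_apply, Hom.comp_apply, omegaMap_of, Hom.comp_apply, Hom.comp_apply,
          omegaMap_of, Calculus.ofOmega, omegaLift_of, ← E.trivOf_inl]
        exact (E.χΓ_ofP Γ ΓH j (E.ι b)).trans (congrArg _ (E.χ_ι j b))) y
    refine key.trans ?_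
    rw [Hom.comp_apply, Hom.comp_apply, hx, map_zero]
  have h2 : E.toOverlap Γ ΓH i j (E.χΓ Γ ΓH i z) = 0 := E.toOverlap_χΓ Γ ΓH i j z h1
  refine Eq.trans ?_ h2
  exact omega_hom_ext
    (f := ((E.overlapΩ Γ ΓH i j).comp (omegaMap (E.πr i j))).comp
      (omegaMap (Ideal.Quotient.mkₐ ℂ (J j))))
    (g := (E.toOverlap Γ ΓH i j).comp ((E.χΓ Γ ΓH i).comp
      ((E.toΓP Γ ΓH).comp (omegaMap E.ι))))
    (fun b => by
      rw [Hom.comp_apply, Hom.comp_apply, omegaMap_of, omegaMap_of]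
      refine (E.overlapΩ_of Γ ΓH i j b).trans ?_
      rw [Hom.comp_apply, Hom.comp_apply, Hom.comp_apply, omegaMap_of, ← E.χ_ι]
      exact congrArg _ (E.χΓ_ofP Γ ΓH i (E.ι b)).symm) y

/-- The extension `πⁱⱼ_{Γ_m} : Γ(Bᵢ) → Γ_m(Bᵢⱼ)` of `πⁱⱼ`. -/
def πmL (i j : I) : Hom (Γ i).toDiffAlg (E.ΓmBij Γ ΓH i j) :=
  (Γ i).ofOmega.factor (Γ i).ofOmega_surjective
    ((E.toΓmBij Γ ΓH i j).comp (omegaMap (E.πl i j))) (E.πmL_aux Γ ΓH i j)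

/-- The extension `πʲᵢ_{Γ_m} : Γ(Bⱼ) → Γ_m(Bᵢⱼ)` of `πʲᵢ`. -/
def πmR (i j : I) : Hom (Γ j).toDiffAlg (E.ΓmBij Γ ΓH i j) :=
  (Γ j).ofOmega.factor (Γ j).ofOmega_surjective
    ((E.toΓmBij Γ ΓH i j).comp (omegaMap (E.πr i j))) (E.πmR_aux Γ ΓH i j)

theorem πmL_of (i j : I) (b : B ⧸ J i) :
    E.πmL Γ ΓH i j ((Γ i).of b) = E.toΓmBij Γ ΓH i j (omegaIn _ (E.πl i j b)) := by
  rw [← omegaLift_of (Γ i).of (Γ i).of_mem b]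
  refine ((Γ i).ofOmega.factor_apply _ _ (E.πmL_aux Γ ΓH i j) _).trans ?_
  rw [Hom.comp_apply, omegaMap_of]

theorem πmR_of (i j : I) (b : B ⧸ J j) :
    E.πmR Γ ΓH i j ((Γ j).of b) = E.toΓmBij Γ ΓH i j (omegaIn _ (E.πr i j b)) := by
  rw [← omegaLift_of (Γ j).of (Γ j).of_mem b]
  refine ((Γ j).ofOmega.factor_apply _ _ (E.πmR_aux Γ ΓH i j) _).trans ?_
  rw [Hom.comp_apply, omegaMap_of]

section Gluing

variable [Finite I]

/-- `Γ_m(B) = {(γᵢ)ᵢ ∈ ⨁ᵢ Γ(Bᵢ) | πⁱⱼ_{Γ_m}(γᵢ) = πʲᵢ_{Γ_m}(γⱼ)}`. -/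
def Γm : DiffAlg :=
  gluing (fun i => (Γ i).toDiffAlg) (E.ΓmBij Γ ΓH) (E.πmL Γ ΓH) (E.πmR Γ ΓH)

/-- The homomorphism `B → Γ_m(B)`, `b ↦ (πᵢ(b))ᵢ`. -/
def ofΓm : B →ₐ[ℂ] E.Γm Γ ΓH :=
  AlgHom.codRestrict (AlgHom.pi fun i => (Γ i).of.comp (Ideal.Quotient.mkₐ ℂ (J i)))
    (gluingAlgebra (fun i => (Γ i).toDiffAlg) (E.ΓmBij Γ ΓH) (E.πmL Γ ΓH) (E.πmR Γ ΓH))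
    fun b i j => by
      change E.πmL Γ ΓH i j ((Γ i).of (Ideal.Quotient.mk (J i) b)) =
        E.πmR Γ ΓH i j ((Γ j).of (Ideal.Quotient.mk (J j) b))
      rw [πmL_of, πmR_of]
      rfl

/-- The projection `Γ_m(B) → Γ(Bᵢ)`, `(γₖ)ₖ ↦ γᵢ`. -/
def πm (i : I) : Hom (E.Γm Γ ΓH) (Γ i).toDiffAlg := gluingProj _ _ _ _ i

/-- `Γg`, with the inclusion `of : B → Γg⁰` and the projections `πᵢ : Γg → Γ(Bᵢ)`, is an
LC-differential algebra over `B` which is embeddable into `Γ_c(P)`: it is an LC-differential algebra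
with respect to the differential ideals `ker πᵢ`, its local differential calculi are the `Γ(Bᵢ)` (by
means of the isomorphisms `Γg/ker πᵢ ≅ Γ(Bᵢ)` induced by the extensions `πᵢ` of the canonical
projections `B → Bᵢ`), and there is an extension `ι_Γg : Γg → Γ_c(P)` of `ι : B → P` such that
`χᵢ_{Γ_c}(ι_Γg(γ)) = πᵢ(γ) ⊗̂ 1`. -/
structure IsEmbeddable (Γg : DiffAlg) (of : B →ₐ[ℂ] Γg)
    (π : ∀ i, Hom Γg (Γ i).toDiffAlg) : Prop where
  isLC : IsLC Γg of fun i => DiffIdeal.ker (π i)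
  π_surjective : ∀ i, Function.Surjective (π i)
  π_of : ∀ i b, π i (of b) = (Γ i).of (Ideal.Quotient.mk (J i) b)
  embedding : ∃ ιg : Hom Γg (E.ΓcP Γ ΓH),
    (∀ b, ιg (of b) = E.ofPc Γ ΓH (E.ι b)) ∧
    ∀ i γ, E.χΓc Γ ΓH i (ιg γ) = E.trivInl Γ ΓH i (π i γ)

end Gluing

end QPFB

end

/-! Forms `γ` over `Bᵢ` and `δ` over `Bⱼ` have the same image in `Γ_m(Bᵢⱼ)` if and only if lifts to
`Γ(P)` of their pull-backs `γ ⊗̂ 1` and `δ ⊗̂ 1` agree modulo `ker χᵢ_Γ + ker χⱼ_Γ`. Hence a family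
`(γᵢ)ᵢ` belongs to `Γ_m(B)` exactly when `(γᵢ ⊗̂ 1)ᵢ` is the family of components of an element of
`Γ_c(P)`; this gives both the embedding of `Γ_m(B)` and its maximality.

The degree-zero part of `Γ_m(B)` is no larger than `B`: in degree zero `ker χᵢ_Γ + ker χⱼ_Γ` reduces
to `ker χᵢ + ker χⱼ`, so by completeness of the covering of `P` a compatible family `(bᵢ)ᵢ` comes
from some `p` in `P` with `χᵢ(p) = bᵢ ⊗ 1`. As the `χᵢ ⊗ id` are jointly injective, by flatness of
`H`, this `p` is coinvariant and therefore lies in the image of `B`. -/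

noncomputable section

namespace DiffAlg

section AdjoinDiff

variable {A : Type*} [Ring A] [Algebra ℂ A] {Γ Λ : DiffAlg}

/-- The subalgebra of `Γ` generated by the image of `A` and its differentials; a differential
algebra over `A` is a differential calculus if and only if this is everything. -/
def adjoinDiff (of : A →ₐ[ℂ] Γ) : Subalgebra ℂ Γ :=
  Algebra.adjoin ℂ (Set.range of ∪ Set.range fun a => Γ.d (of a))

theorem adjoinDiff_hom_comp (f : Hom Γ Λ) (of : A →ₐ[ℂ] Γ) :
    adjoinDiff (f.toAlgHom.comp of) = (adjoinDiff of).map f.toAlgHom := by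
  have hd : (fun a => Λ.d (f.toAlgHom.comp of a)) = f ∘ fun a => Γ.d (of a) :=
    funext fun a => (f.comm_d (of a)).symm
  rw [adjoinDiff, adjoinDiff, AlgHom.map_adjoin, Set.image_union, ← Set.range_comp,
    ← Set.range_comp, hd, AlgHom.coe_comp]

theorem adjoinDiff_comp_of_surjective {A' : Type*} [Ring A'] [Algebra ℂ A'] (of : A →ₐ[ℂ] Γ)
    {g : A' →ₐ[ℂ] A} (hg : Function.Surjective g) : adjoinDiff (of.comp g) = adjoinDiff of := by
  have hd : (Set.range fun a => Γ.d (of.comp g a)) = Set.range fun a => Γ.d (of a) :=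
    hg.range_comp fun a => Γ.d (of a)
  rw [adjoinDiff, adjoinDiff, hd, AlgHom.coe_comp, hg.range_comp]

theorem surjective_of_adjoinDiff_hom_comp_eq_top {f : Hom Γ Λ} {of : A →ₐ[ℂ] Γ}
    (h : adjoinDiff (f.toAlgHom.comp of) = ⊤) : Function.Surjective f := by
  rw [adjoinDiff_hom_comp] at h
  intro y
  obtain ⟨x, -, hx⟩ := h.ge (Algebra.mem_top (x := y))
  exact ⟨x, hx⟩

theorem proj_zero_mem_range_of_mem_adjoinDiff {of : A →ₐ[ℂ] Γ} (hof : ∀ a, of a ∈ Γ.deg 0) {x : Γ}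
    (hx : x ∈ adjoinDiff of) : Γ.proj 0 x ∈ of.range := by
  have proj_zero_mul (x y : Γ) : Γ.proj 0 (x * y) = Γ.proj 0 x * Γ.proj 0 y :=
    map_mul (GradedRing.projZeroRingHom Γ.deg) x y
  have proj_zero_of (a : A) : Γ.proj 0 (of a) = of a := by
    rw [Γ.proj_of_mem 0 0 _ (hof a), if_pos rfl]
  induction hx using Algebra.adjoin_induction with
  | mem x hx =>
    obtain ⟨a, rfl⟩ | ⟨a, rfl⟩ := hx
    · exact ⟨a, (proj_zero_of a).symm⟩
    · rw [Γ.proj_of_mem 0 1 _ (Γ.d_mem (hof a)), if_neg zero_ne_one]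
      exact zero_mem _
  | algebraMap c => exact ⟨algebraMap ℂ A c, by rw [← of.commutes]; exact (proj_zero_of _).symm⟩
  | add x y _ _ hx hy => rw [map_add]; exact add_mem hx hy
  | mul x y _ _ hx hy => rw [proj_zero_mul]; exact of.range.mul_mem hx hy

theorem isCalculus_of_adjoinDiff_eq_top {of : A →ₐ[ℂ] Γ} (hinj : Function.Injective of)
    (hof : ∀ a, of a ∈ Γ.deg 0) (h : adjoinDiff of = ⊤) : IsCalculus Γ of where
  injective := hinj
  range_eq x := by
    refine ⟨fun hx => ?_, fun ⟨a, ha⟩ => ha ▸ hof a⟩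
    have hproj := proj_zero_mem_range_of_mem_adjoinDiff hof (h.ge (Algebra.mem_top (x := x)))
    rwa [Γ.proj_of_mem 0 0 x hx, if_pos rfl] at hproj
  generated := h

end AdjoinDiff

section Ideals

variable {Γ Λ Θ : DiffAlg} {A B : Type*} [Ring A] [Algebra ℂ A] [Ring B] [Algebra ℂ B]

namespace DiffIdeal

theorem toQuot_eq_toQuot_iff (K : DiffIdeal Γ) {x y : Γ} :
    K.toQuot x = K.toQuot y ↔ x - y ∈ K.ideal := Ideal.Quotient.eq

/-- The homomorphism `Γ/ker f → Λ` induced by `f : Γ → Λ`. -/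
def kerLift (f : Hom Γ Λ) : Hom (ker f).quot Λ := (ker f).lift f fun _ hx => hx

theorem kerLift_injective (f : Hom Γ Λ) : Function.Injective (kerLift f) := by
  rw [injective_iff_map_eq_zero]
  intro x hx
  obtain ⟨x, rfl⟩ := (ker f).toQuot_surjective x
  exact ((ker f).toQuot_eq_zero x).mpr hx

/-- The inverse `Λ → Γ/ker f` of the isomorphism induced by a surjection `f : Γ → Λ`. -/
def kerLiftInv (f : Hom Γ Λ) (hf : Function.Surjective f) : Hom Λ (ker f).quot :=
  f.factor hf (ker f).toQuot fun x hx => ((ker f).toQuot_eq_zero x).mpr hx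

theorem kerLiftInv_apply (f : Hom Γ Λ) (hf : Function.Surjective f) (x : Γ) :
    kerLiftInv f hf (f x) = (ker f).toQuot x := f.factor_apply _ _ _ x

theorem toQuot_map_apply_eq_zero_iff (f : Hom Γ Λ) (hf : Function.Surjective f) (K : DiffIdeal Γ)
    (x : Γ) : (K.map f hf).toQuot (f x) = 0 ↔ x ∈ ((ker f).sup K).ideal := by
  have h : (K.ideal.map f.toAlgHom).comap f.toAlgHom = (ker f).ideal ⊔ K.ideal :=
    (Ideal.comap_map_of_surjective' f.toAlgHom hf K.ideal).trans (sup_comm _ _)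
  exact ((K.map f hf).toQuot_eq_zero _).trans (iff_of_eq (congrArg (x ∈ ·) h))

theorem degZero_ker {f : Hom Γ Λ} {of : A →ₐ[ℂ] Γ} {of' : B →ₐ[ℂ] Λ} {g : A →ₐ[ℂ] B}
    (hof' : Function.Injective of') (h : ∀ a, f (of a) = of' (g a)) :
    (ker f).degZero of = RingHom.ker g := by
  ext a
  change f (of a) = 0 ↔ g a = 0
  rw [h, map_eq_zero_iff of' hof']

/-- Degree-zero parts of elements of `K` and `L` lie again in `K` and `L`, so a decomposition of an
element of `A` can be taken in `A`. -/
theorem degZero_sup {of : A →ₐ[ℂ] Γ} (hof : IsOver Γ of) (K L : DiffIdeal Γ) :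
    (K.sup L).degZero of = K.degZero of ⊔ L.degZero of := by
  refine le_antisymm (fun a ha => ?_)
    (sup_le (Ideal.comap_mono le_sup_left) (Ideal.comap_mono le_sup_right))
  obtain ⟨x, hx, y, hy, hxy⟩ := Submodule.mem_sup.mp ha
  obtain ⟨b, hb⟩ := (hof.range_eq _).mp (Γ.proj_mem 0 x)
  obtain ⟨c, hc⟩ := (hof.range_eq _).mp (Γ.proj_mem 0 y)
  have hbc : b + c = a := hof.injective <| by
    have ha0 : of a ∈ Γ.deg 0 := (hof.range_eq _).mpr ⟨a, rfl⟩
    rw [map_add, show of b = _ from hb, show of c = _ from hc, ← map_add, hxy,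
      Γ.proj_of_mem 0 0 _ ha0, if_pos rfl]
  have hbK : of b ∈ K.ideal := (show of b = _ from hb) ▸ K.graded 0 hx
  have hcL : of c ∈ L.ideal := (show of c = _ from hc) ▸ L.graded 0 hy
  exact hbc ▸ Submodule.add_mem_sup hbK hcL

end DiffIdeal

theorem isCalculus_quot_ker {f : Hom Γ Λ} {of : A →ₐ[ℂ] Γ} (hof : ∀ a, of a ∈ Γ.deg 0)
    (hf : adjoinDiff (f.toAlgHom.comp of) = ⊤) :
    IsCalculus (DiffIdeal.ker f).quot ((DiffIdeal.ker f).quotOf of) := by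
  set K := DiffIdeal.ker f
  have hmk : Function.Surjective (Ideal.Quotient.mkₐ ℂ (K.degZero of)) :=
    Ideal.Quotient.mkₐ_surjective ℂ _
  refine isCalculus_of_adjoinDiff_eq_top ?_ (fun a => ?_) ?_
  · rw [injective_iff_map_eq_zero]
    intro a ha
    obtain ⟨a, rfl⟩ := hmk a
    exact Ideal.Quotient.eq_zero_iff_mem.mpr ((K.toQuot_eq_zero _).mp ha)
  · obtain ⟨a, rfl⟩ := hmk a
    exact K.toQuot.map_mem (hof a)
  · apply Subalgebra.map_injective (DiffIdeal.kerLift_injective f)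
    have hcomp : ((DiffIdeal.kerLift f).toAlgHom.comp (K.quotOf of)).comp
        (Ideal.Quotient.mkₐ ℂ (K.degZero of)) = f.toAlgHom.comp of := rfl
    rw [← adjoinDiff_hom_comp, ← adjoinDiff_comp_of_surjective _ hmk, hcomp, hf, Algebra.map_top,
      eq_comm, AlgHom.range_eq_top]
    have hsurj := surjective_of_adjoinDiff_hom_comp_eq_top hf
    exact fun y => (hsurj y).imp' K.toQuot fun _ hx => hx

/-- The projection `Γ → Γ/(ker f + ker g)` onto the pushout of surjections `f` and `g`. -/
def Hom.toPushout (f : Hom Γ Λ) (g : Hom Γ Θ) :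
    Hom Γ ((DiffIdeal.ker f).sup (DiffIdeal.ker g)).quot := DiffIdeal.toQuot _

theorem Hom.toPushout_eq_of_left_eq (f : Hom Γ Λ) (g : Hom Γ Θ) {x y : Γ} (h : f x = f y) :
    f.toPushout g x = f.toPushout g y := by
  refine (DiffIdeal.toQuot_eq_toQuot_iff _).mpr (Submodule.mem_sup_left ?_)
  change f (x - y) = 0
  rw [map_sub, h, sub_self]

theorem Hom.toPushout_eq_of_right_eq (f : Hom Γ Λ) (g : Hom Γ Θ) {x y : Γ} (h : g x = g y) :
    f.toPushout g x = f.toPushout g y := by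
  refine (DiffIdeal.toQuot_eq_toQuot_iff _).mpr (Submodule.mem_sup_right ?_)
  change g (x - y) = 0
  rw [map_sub, h, sub_self]

end Ideals

section Gluing

variable {I : Type*} [Finite I] {Γ : I → DiffAlg} {Λ : I → I → DiffAlg}
  {p : ∀ i j, Hom (Γ i) (Λ i j)} {q : ∀ i j, Hom (Γ j) (Λ i j)} {Θ : DiffAlg}

theorem gluing_ext {x y : gluing Γ Λ p q}
    (h : ∀ i, gluingProj Γ Λ p q i x = gluingProj Γ Λ p q i y) : x = y :=
  Subtype.ext (funext h)

theorem gluingProj_compatible (x : gluing Γ Λ p q) (i j : I) :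
    p i j (gluingProj Γ Λ p q i x) = q i j (gluingProj Γ Λ p q j x) := x.2 i j

theorem iInf_ker_gluingProj_eq_bot :
    ⨅ i, (DiffIdeal.ker (gluingProj Γ Λ p q i)).ideal = ⊥ := by
  rw [eq_bot_iff]
  intro x hx
  rw [Submodule.mem_iInf] at hx
  exact gluing_ext fun i => (hx i).trans (map_zero _).symm

/-- The homomorphism into a gluing given by compatible homomorphisms into the pieces. -/
def gluingLift (f : ∀ i, Hom Θ (Γ i)) (hf : ∀ i j x, p i j (f i x) = q i j (f j x)) :
    Hom Θ (gluing Γ Λ p q) where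
  toAlgHom := AlgHom.codRestrict (AlgHom.pi fun i => (f i).toAlgHom) (gluingAlgebra Γ Λ p q)
    fun x i j => hf i j x
  map_deg hx i := (f i).map_mem hx
  map_d x := Subtype.ext (funext fun i => (f i).comm_d x)

theorem gluingProj_gluingLift (f : ∀ i, Hom Θ (Γ i)) (hf : ∀ i j x, p i j (f i x) = q i j (f j x))
    (i : I) (x : Θ) : gluingProj Γ Λ p q i (gluingLift f hf x) = f i x := rfl

theorem gluingLift_injective {f : ∀ i, Hom Θ (Γ i)}
    (hf : ∀ i j x, p i j (f i x) = q i j (f j x))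
    (h : ⨅ i, (DiffIdeal.ker (f i)).ideal = ⊥) :
    Function.Injective (gluingLift f hf : Hom Θ (gluing Γ Λ p q)) := by
  rw [injective_iff_map_eq_zero]
  intro x hx
  have hmem : x ∈ ⨅ i, (DiffIdeal.ker (f i)).ideal :=
    (Submodule.mem_iInf _).mpr fun i => congrArg (gluingProj Γ Λ p q i) hx
  rwa [h] at hmem

end Gluing

section Completion

variable {I : Type*} [Finite I] {Γ Θ : DiffAlg} {Λ : I → DiffAlg} (f : ∀ i, Hom Γ (Λ i))

/-- The `i`-th component, seen in `Λᵢ`, of an element of the covering completion of `Γ` with respect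
to the kernels of homomorphisms `fᵢ : Γ → Λᵢ`. -/
def completionEval (i : I) : Hom (completion Γ fun i => DiffIdeal.ker (f i)) (Λ i) :=
  (DiffIdeal.kerLift (f i)).comp (completionProj Γ _ i)

variable {f}

theorem completion_ext {x y : completion Γ fun i => DiffIdeal.ker (f i)}
    (h : ∀ i, completionEval f i x = completionEval f i y) : x = y :=
  gluing_ext fun i => DiffIdeal.kerLift_injective (f i) (h i)

theorem toPushout_eq_of_completionEval {x : completion Γ fun i => DiffIdeal.ker (f i)} {i j : I}
    {y z : Γ} (hy : f i y = completionEval f i x) (hz : f j z = completionEval f j x) :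
    (f i).toPushout (f j) y = (f i).toPushout (f j) z := by
  have hxy : (DiffIdeal.ker (f i)).toQuot y = completionProj Γ _ i x :=
    DiffIdeal.kerLift_injective (f i) hy
  have hxz : (DiffIdeal.ker (f j)).toQuot z = completionProj Γ _ j x :=
    DiffIdeal.kerLift_injective (f j) hz
  have hx := gluingProj_compatible x i j
  exact (congrArg (DiffIdeal.lift _ _ _) hxy).trans
    (hx.trans (congrArg (DiffIdeal.lift _ _ _) hxz.symm))

/-- The homomorphism into the covering completion whose components, seen in the `Λᵢ`, are given
homomorphisms `gᵢ` with compatible lifts to `Γ`. -/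
def completionLift (hf : ∀ i, Function.Surjective (f i)) (g : ∀ i, Hom Θ (Λ i))
    (hg : ∀ i j x y z, f i y = g i x → f j z = g j x →
      (f i).toPushout (f j) y = (f i).toPushout (f j) z) :
    Hom Θ (completion Γ fun i => DiffIdeal.ker (f i)) :=
  gluingLift (fun i => (DiffIdeal.kerLiftInv (f i) (hf i)).comp (g i)) fun i j x => by
    obtain ⟨y, hy⟩ := hf i (g i x)
    obtain ⟨z, hz⟩ := hf j (g j x)
    rw [Hom.comp_apply, Hom.comp_apply, ← hy, ← hz, DiffIdeal.kerLiftInv_apply,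
      DiffIdeal.kerLiftInv_apply]
    exact hg i j x y z hy hz

theorem completionEval_completionLift (hf : ∀ i, Function.Surjective (f i))
    (g : ∀ i, Hom Θ (Λ i)) (hg : ∀ i j x y z, f i y = g i x → f j z = g j x →
      (f i).toPushout (f j) y = (f i).toPushout (f j) z) (i : I) (x : Θ) :
    completionEval f i (completionLift hf g hg x) = g i x := by
  obtain ⟨y, hy⟩ := hf i (g i x)
  change DiffIdeal.kerLift (f i) (DiffIdeal.kerLiftInv (f i) (hf i) (g i x)) = g i x
  rw [← hy, DiffIdeal.kerLiftInv_apply]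
  rfl

end Completion

section Skew

variable {Γ Λ : DiffAlg} {A H : Type*} [Ring A] [Algebra ℂ A] [Ring H] [Algebra ℂ H]
  (f : A →ₐ[ℂ] Γ) (g : H →ₐ[ℂ] Λ) (hf : ∀ a, f a ∈ Γ.deg 0) (hg : ∀ h, g h ∈ Λ.deg 0)

theorem skewOf_eq_of_map (x : A ⊗[ℂ] H) : skewOf f g hf hg x =
    GradedTensorProduct.of ℂ Γ.deg Λ.deg (TensorProduct.map f.toLinearMap g.toLinearMap x) := by
  induction x using TensorProduct.induction_on with
  | zero => simp only [map_zero]; rfl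
  | tmul a h => exact (Algebra.TensorProduct.lift_tmul ..).trans (skewInl_mul_skewInr Γ Λ _ _)
  | add x y hx hy => simp only [map_add, hx, hy]; rfl

variable {f g} in
theorem skewOf_injective (hf' : Function.Injective f) (hg' : Function.Injective g) :
    Function.Injective (skewOf f g hf hg) := by
  intro x y hxy
  rw [skewOf_eq_of_map, skewOf_eq_of_map] at hxy
  exact TensorProduct.map_injective_of_flat_flat _ _ hf' hg'
    ((GradedTensorProduct.of ℂ Γ.deg Λ.deg).injective hxy)

end Skew

end DiffAlg

theorem iInf_ker_rTensor_eq_bot {R I M : Type*} [CommRing R] [Finite I] [AddCommGroup M]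
    [Module R M] {Q : I → Type*} [∀ i, AddCommGroup (Q i)] [∀ i, Module R (Q i)]
    {f : ∀ i, M →ₗ[R] Q i} (hf : ⨅ i, (f i).ker = ⊥) (N : Type*) [AddCommGroup N] [Module R N]
    [Module.Flat R N] : ⨅ i, ((f i).rTensor N).ker = ⊥ := by
  classical
  have := Fintype.ofFinite I
  have hpi : (LinearMap.pi fun i => (f i).rTensor N) =
      (TensorProduct.piLeft R N Q).toLinearMap ∘ₗ (LinearMap.pi f).rTensor N :=
    TensorProduct.ext' fun x y => by ext i; simp
  rw [← LinearMap.ker_pi] at hf ⊢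
  rw [hpi, LinearMap.ker_eq_bot]
  exact (TensorProduct.piLeft R N Q).injective.comp
    (Module.Flat.rTensor_preserves_injective_linearMap _ (LinearMap.ker_eq_bot.mp hf))

theorem IsCompleteCovering.exists_sub_mem {I A : Type*} [Ring A] {J : I → Ideal A}
    (h : IsCompleteCovering J) (a : I → A) (ha : ∀ i j, a i - a j ∈ J i ⊔ J j) :
    ∃ x, ∀ i, a i - x ∈ J i := by
  obtain ⟨x, hx⟩ := h.complete (fun i => Submodule.Quotient.mk (a i))
    fun i j => (Submodule.Quotient.eq _).mpr (ha i j)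
  exact ⟨x, fun i => (Submodule.Quotient.eq _).mp (hx i)⟩

namespace QPFB

open DiffAlg

variable {I : Type*} {B H P : Type*} [Ring B] [Algebra ℂ B] [Ring H] [HopfAlgebra ℂ H]
  [Ring P] [Algebra ℂ P] {J : I → Ideal B} [∀ i, (J i).IsTwoSided] (E : QPFB B H P J)
  (Γ : ∀ i, Calculus (B ⧸ J i)) (ΓH : Calculus H)

/-- The extension `Ω(B) → Γ(Bᵢ)` of the projection `B → Bᵢ`. -/
def baseΩ (i : I) : Hom (omega B) (Γ i).toDiffAlg :=
  (Γ i).ofOmega.comp (omegaMap (Ideal.Quotient.mkₐ ℂ (J i)))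

theorem baseΩ_of (i : I) (b : B) :
    baseΩ Γ i (omegaIn B b) = (Γ i).of (Ideal.Quotient.mk (J i) b) := by
  rw [baseΩ, Hom.comp_apply, omegaMap_of]
  exact omegaLift_of ..

theorem baseΩ_surjective (i : I) : Function.Surjective (baseΩ Γ i) :=
  (Γ i).ofOmega_surjective.comp (omegaMap_surjective _ (Ideal.Quotient.mkₐ_surjective ℂ (J i)))

/-- The extension `Ω(B) → Γ(P)` of the embedding `ι : B → P`. -/
def ιΩ : Hom (omega B) (E.ΓP Γ ΓH) := (E.toΓP Γ ΓH).comp (omegaMap E.ι)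

theorem ιΩ_of (b : B) : E.ιΩ Γ ΓH (omegaIn B b) = E.ofP Γ ΓH (E.ι b) := by
  rw [ιΩ, Hom.comp_apply, omegaMap_of]
  rfl

theorem χΓ_ofP_ι (i : I) (b : B) : E.χΓ Γ ΓH i (E.ofP Γ ΓH (E.ι b)) =
    E.trivInl Γ ΓH i ((Γ i).of (Ideal.Quotient.mk (J i) b)) := by
  rw [χΓ_ofP, χ_ι, trivOf_inl]

theorem χΓ_ιΩ (i : I) (u : omega B) :
    E.χΓ Γ ΓH i (E.ιΩ Γ ΓH u) = E.trivInl Γ ΓH i (baseΩ Γ i u) :=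
  omega_hom_ext (f := (E.χΓ Γ ΓH i).comp (E.ιΩ Γ ΓH)) (g := (E.trivInl Γ ΓH i).comp (baseΩ Γ i))
    (fun b => by rw [Hom.comp_apply, ιΩ_of, Hom.comp_apply, baseΩ_of, χΓ_ofP_ι]) u

theorem overlapΩ_omegaMap_mk (i j : I) (u : omega B) :
    E.overlapΩ Γ ΓH i j (omegaMap (Ideal.Quotient.mkₐ ℂ (J i ⊔ J j)) u) =
      E.toOverlap Γ ΓH i j (E.χΓ Γ ΓH i (E.ιΩ Γ ΓH u)) :=
  omega_hom_ext (f := (E.overlapΩ Γ ΓH i j).comp (omegaMap (Ideal.Quotient.mkₐ ℂ (J i ⊔ J j))))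
    (g := (E.toOverlap Γ ΓH i j).comp ((E.χΓ Γ ΓH i).comp (E.ιΩ Γ ΓH)))
    (fun b => by
      rw [Hom.comp_apply, omegaMap_of]
      refine (E.overlapΩ_of Γ ΓH i j b).trans ?_
      rw [Hom.comp_apply, Hom.comp_apply, ιΩ_of, χΓ_ofP_ι, trivOf_inl]) u

theorem πmL_baseΩ (i j : I) (u : omega B) : E.πmL Γ ΓH i j (baseΩ Γ i u) =
    E.toΓmBij Γ ΓH i j (omegaMap (Ideal.Quotient.mkₐ ℂ (J i ⊔ J j)) u) :=
  omega_hom_ext (f := (E.πmL Γ ΓH i j).comp (baseΩ Γ i))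
    (g := (E.toΓmBij Γ ΓH i j).comp (omegaMap (Ideal.Quotient.mkₐ ℂ (J i ⊔ J j))))
    (fun b => by
      rw [Hom.comp_apply, Hom.comp_apply, baseΩ_of, πmL_of, omegaMap_of]
      rfl) u

theorem πmR_baseΩ (i j : I) (u : omega B) : E.πmR Γ ΓH i j (baseΩ Γ j u) =
    E.toΓmBij Γ ΓH i j (omegaMap (Ideal.Quotient.mkₐ ℂ (J i ⊔ J j)) u) :=
  omega_hom_ext (f := (E.πmR Γ ΓH i j).comp (baseΩ Γ j))
    (g := (E.toΓmBij Γ ΓH i j).comp (omegaMap (Ideal.Quotient.mkₐ ℂ (J i ⊔ J j))))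
    (fun b => by
      rw [Hom.comp_apply, Hom.comp_apply, baseΩ_of, πmR_of, omegaMap_of]
      rfl) u

theorem toΓmBij_omegaMap_mk_eq_zero_iff (i j : I) (w : omega B) :
    E.toΓmBij Γ ΓH i j (omegaMap (Ideal.Quotient.mkₐ ℂ (J i ⊔ J j)) w) = 0 ↔
      (E.χΓ Γ ΓH i).toPushout (E.χΓ Γ ΓH j) (E.ιΩ Γ ΓH w) = 0 := by
  have hker : E.toΓmBij Γ ΓH i j (omegaMap (Ideal.Quotient.mkₐ ℂ (J i ⊔ J j)) w) = 0 ↔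
      E.overlapΩ Γ ΓH i j (omegaMap (Ideal.Quotient.mkₐ ℂ (J i ⊔ J j)) w) = 0 :=
    DiffIdeal.toQuot_eq_zero _ _
  rw [hker, overlapΩ_omegaMap_mk]
  exact (DiffIdeal.toQuot_map_apply_eq_zero_iff ..).trans (DiffIdeal.toQuot_eq_zero _ _).symm

theorem πmL_eq_πmR_iff {i j : I} {γ : (Γ i).toDiffAlg} {δ : (Γ j).toDiffAlg} {y z : E.ΓP Γ ΓH}
    (hy : E.χΓ Γ ΓH i y = E.trivInl Γ ΓH i γ) (hz : E.χΓ Γ ΓH j z = E.trivInl Γ ΓH j δ) :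
    E.πmL Γ ΓH i j γ = E.πmR Γ ΓH i j δ ↔
      (E.χΓ Γ ΓH i).toPushout (E.χΓ Γ ΓH j) y = (E.χΓ Γ ΓH i).toPushout (E.χΓ Γ ΓH j) z := by
  obtain ⟨u, rfl⟩ := baseΩ_surjective Γ i γ
  obtain ⟨v, rfl⟩ := baseΩ_surjective Γ j δ
  rw [← χΓ_ιΩ] at hy hz
  rw [Hom.toPushout_eq_of_left_eq _ _ hy, Hom.toPushout_eq_of_right_eq _ _ hz, πmL_baseΩ,
    πmR_baseΩ, ← sub_eq_zero, ← map_sub, ← map_sub, toΓmBij_omegaMap_mk_eq_zero_iff, map_sub,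
    map_sub, sub_eq_zero]

theorem trivOf_injective (i : I) : Function.Injective (E.trivOf Γ ΓH i) :=
  skewOf_injective _ _ (Γ i).isCalculus.injective ΓH.isCalculus.injective

theorem ofP_injective : Function.Injective (E.ofP Γ ΓH) := by
  rw [injective_iff_map_eq_zero]
  intro p hp
  have hmem : p ∈ ⨅ i, RingHom.ker (E.χ i) := (Submodule.mem_iInf _).mpr fun i =>
    E.trivOf_injective Γ ΓH i <| by rw [← χΓ_ofP, hp, map_zero, map_zero]
  rwa [E.total_covering.iInf_eq_bot] at hmem

theorem isCalculus_ΓP : IsCalculus (E.ΓP Γ ΓH) (E.ofP Γ ΓH) := by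
  refine isCalculus_of_adjoinDiff_eq_top (E.ofP_injective Γ ΓH)
    (fun p => (E.toΓP Γ ΓH).map_mem (omegaOf_mem p)) ?_
  have htop : adjoinDiff (omegaIn P) = ⊤ := omega_generated
  rw [ofP, adjoinDiff_hom_comp, htop, Algebra.map_top, AlgHom.range_eq_top]
  exact DiffIdeal.toQuot_surjective _

theorem toPushout_ofP_eq_iff {i j : I} {p q : P} :
    (E.χΓ Γ ΓH i).toPushout (E.χΓ Γ ΓH j) (E.ofP Γ ΓH p) =
      (E.χΓ Γ ΓH i).toPushout (E.χΓ Γ ΓH j) (E.ofP Γ ΓH q) ↔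
    p - q ∈ RingHom.ker (E.χ i) ⊔ RingHom.ker (E.χ j) := by
  have degZero_ker_χΓ (k : I) :
      (DiffIdeal.ker (E.χΓ Γ ΓH k)).degZero (E.ofP Γ ΓH) = RingHom.ker (E.χ k) :=
    DiffIdeal.degZero_ker (E.trivOf_injective Γ ΓH k) (E.χΓ_ofP Γ ΓH k)
  rw [← degZero_ker_χΓ i, ← degZero_ker_χΓ j,
    ← DiffIdeal.degZero_sup (E.isCalculus_ΓP Γ ΓH).toIsOver]
  exact (DiffIdeal.toQuot_eq_toQuot_iff _).trans (by rw [← map_sub]; rfl)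

section Finite

variable [Finite I]

theorem mem_range_ι_of_χ_eq {p : P} {b : ∀ i, B ⧸ J i} (hp : ∀ i, E.χ i p = b i ⊗ₜ 1) :
    p ∈ E.ι.range := by
  have hχ : ⨅ i, (E.χ i).toLinearMap.ker = ⊥ := eq_bot_iff.mpr fun x hx =>
    E.total_covering.iInf_eq_bot.le <| (Submodule.mem_iInf _).mpr <|
      (Submodule.mem_iInf fun i => (E.χ i).toLinearMap.ker).mp hx
  rw [range_ι, ← sub_eq_zero, ← Submodule.mem_bot (R := ℂ), ← iInf_ker_rTensor_eq_bot hχ H,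
    Submodule.mem_iInf]
  intro i
  rw [LinearMap.mem_ker, map_sub, sub_eq_zero]
  apply (Algebra.TensorProduct.assoc ℂ ℂ ℂ (B ⧸ J i) H H).injective
  refine (DFunLike.congr_fun (E.χ_coaction i) p).symm.trans ?_
  change Algebra.TensorProduct.map (AlgHom.id ℂ (B ⧸ J i)) (Bialgebra.comulAlgHom ℂ H) (E.χ i p) =
    Algebra.TensorProduct.assoc ℂ ℂ ℂ (B ⧸ J i) H H (E.χ i p ⊗ₜ 1)
  rw [hp, Algebra.TensorProduct.map_tmul, map_one]
  rfl

theorem exists_mk_eq_of_sub_mem {b : I → B}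
    (hb : ∀ i j, E.ι (b i) - E.ι (b j) ∈ RingHom.ker (E.χ i) ⊔ RingHom.ker (E.χ j)) :
    ∃ a : B, ∀ i, Ideal.Quotient.mk (J i) a = Ideal.Quotient.mk (J i) (b i) := by
  obtain ⟨p, hp⟩ := E.total_covering.exists_sub_mem _ hb
  have hχ (i : I) : E.χ i p = Ideal.Quotient.mk (J i) (b i) ⊗ₜ 1 := by
    rw [← E.χ_ι, eq_comm, ← sub_eq_zero, ← map_sub]
    exact hp i
  obtain ⟨a, rfl⟩ := E.mem_range_ι_of_χ_eq hχ
  exact ⟨a, fun i => Algebra.TensorProduct.includeLeft_injective (S := ℂ)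
    (Bialgebra.algebraMap_injective H) ((E.χ_ι i a).symm.trans (hχ i))⟩

theorem ofΓm_injective : Function.Injective (E.ofΓm Γ ΓH) := by
  rw [injective_iff_map_eq_zero]
  intro b hb
  have hmem : b ∈ ⨅ i, J i := (Submodule.mem_iInf _).mpr fun i => by
    rw [← Ideal.Quotient.eq_zero_iff_mem, ← map_eq_zero_iff _ (Γ i).isCalculus.injective]
    exact congrArg (E.πm Γ ΓH i) hb
  rwa [E.base_covering.iInf_eq_bot] at hmem

theorem isOver_Γm : IsOver (E.Γm Γ ΓH) (E.ofΓm Γ ΓH) where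
  injective := E.ofΓm_injective Γ ΓH
  range_eq x := by
    refine ⟨fun hx => ?_, fun ⟨b, hb⟩ => hb ▸ fun i => (Γ i).of_mem _⟩
    have hlift (i : I) : ∃ b, (Γ i).of (Ideal.Quotient.mk (J i) b) = E.πm Γ ΓH i x := by
      obtain ⟨b, hb⟩ := ((Γ i).isCalculus.range_eq _).mp (hx i)
      obtain ⟨b, rfl⟩ := Ideal.Quotient.mk_surjective b
      exact ⟨b, hb⟩
    choose b hb using hlift
    have hχ (i : I) : E.χΓ Γ ΓH i (E.ofP Γ ΓH (E.ι (b i))) = E.trivInl Γ ΓH i (E.πm Γ ΓH i x) := by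
      rw [χΓ_ofP_ι, hb]
    obtain ⟨a, ha⟩ := E.exists_mk_eq_of_sub_mem fun i j =>
      (E.toPushout_ofP_eq_iff Γ ΓH).mp <|
        (E.πmL_eq_πmR_iff Γ ΓH (hχ i) (hχ j)).mp (gluingProj_compatible x i j)
    exact ⟨a, gluing_ext fun i => (congrArg (Γ i).of (ha i)).trans (hb i)⟩

theorem adjoinDiff_πm_ofΓm (i : I) :
    adjoinDiff ((E.πm Γ ΓH i).toAlgHom.comp (E.ofΓm Γ ΓH)) = ⊤ := by
  have hcomp : (E.πm Γ ΓH i).toAlgHom.comp (E.ofΓm Γ ΓH) =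
      (Γ i).of.comp (Ideal.Quotient.mkₐ ℂ (J i)) := rfl
  rw [hcomp, adjoinDiff_comp_of_surjective _ (Ideal.Quotient.mkₐ_surjective ℂ _)]
  exact (Γ i).isCalculus.generated

theorem degZero_ker_πm (i : I) : (DiffIdeal.ker (E.πm Γ ΓH i)).degZero (E.ofΓm Γ ΓH) = J i :=
  (DiffIdeal.degZero_ker (g := Ideal.Quotient.mkₐ ℂ (J i)) (Γ i).isCalculus.injective
    fun _ => rfl).trans (Ideal.Quotient.mkₐ_ker ℂ (J i))

theorem isLC_Γm (hJ : ∀ i, J i ≠ ⊥) :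
    IsLC (E.Γm Γ ΓH) (E.ofΓm Γ ΓH) fun i => DiffIdeal.ker (E.πm Γ ΓH i) where
  isOver := E.isOver_Γm Γ ΓH
  covering := iInf_ker_gluingProj_eq_bot
  calculus i := isCalculus_quot_ker (fun b => ((E.isOver_Γm Γ ΓH).range_eq _).mpr ⟨b, rfl⟩)
    (E.adjoinDiff_πm_ofΓm Γ ΓH i)
  degZero_ne_bot i := (E.degZero_ker_πm Γ ΓH i).trans_ne (hJ i)

/-- The homomorphism `Γ_m(B) → Γ_c(P)` extending `ι`, with components `γᵢ ⊗̂ 1`. -/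
def ιm : Hom (E.Γm Γ ΓH) (E.ΓcP Γ ΓH) :=
  completionLift (E.χΓ_surjective Γ ΓH) (fun i => (E.trivInl Γ ΓH i).comp (E.πm Γ ΓH i))
    fun i j x _ _ hy hz => (E.πmL_eq_πmR_iff Γ ΓH hy hz).mp (gluingProj_compatible x i j)

theorem χΓc_ιm (i : I) (γ : E.Γm Γ ΓH) :
    E.χΓc Γ ΓH i (E.ιm Γ ΓH γ) = E.trivInl Γ ΓH i (E.πm Γ ΓH i γ) :=
  completionEval_completionLift ..

theorem ιm_ofΓm (b : B) : E.ιm Γ ΓH (E.ofΓm Γ ΓH b) = E.ofPc Γ ΓH (E.ι b) :=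
  completion_ext fun i => (E.χΓc_ιm Γ ΓH i _).trans (E.χΓ_ofP_ι Γ ΓH i b).symm

theorem isEmbeddable_Γm (hJ : ∀ i, J i ≠ ⊥) :
    E.IsEmbeddable Γ ΓH (E.Γm Γ ΓH) (E.ofΓm Γ ΓH) (E.πm Γ ΓH) where
  isLC := E.isLC_Γm Γ ΓH hJ
  π_surjective i := surjective_of_adjoinDiff_hom_comp_eq_top (E.adjoinDiff_πm_ofΓm Γ ΓH i)
  π_of _ _ := rfl
  embedding := ⟨E.ιm Γ ΓH, E.ιm_ofΓm Γ ΓH, E.χΓc_ιm Γ ΓH⟩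

theorem πmL_eq_πmR_of_χΓc_eq {x : E.ΓcP Γ ΓH} {γ : ∀ i, (Γ i).toDiffAlg}
    (hx : ∀ i, E.χΓc Γ ΓH i x = E.trivInl Γ ΓH i (γ i)) (i j : I) :
    E.πmL Γ ΓH i j (γ i) = E.πmR Γ ΓH i j (γ j) := by
  obtain ⟨y, hy⟩ := E.χΓ_surjective Γ ΓH i (E.trivInl Γ ΓH i (γ i))
  obtain ⟨z, hz⟩ := E.χΓ_surjective Γ ΓH j (E.trivInl Γ ΓH j (γ j))
  exact (E.πmL_eq_πmR_iff Γ ΓH hy hz).mpr <|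
    toPushout_eq_of_completionEval (hy.trans (hx i).symm) (hz.trans (hx j).symm)

theorem IsEmbeddable.πmL_eq_πmR {E : QPFB B H P J} {Γ : ∀ i, Calculus (B ⧸ J i)} {ΓH : Calculus H}
    {Γg : DiffAlg} {of : B →ₐ[ℂ] Γg} {π : ∀ i, Hom Γg (Γ i).toDiffAlg}
    (h : E.IsEmbeddable Γ ΓH Γg of π) (i j : I) (γ : Γg) :
    E.πmL Γ ΓH i j (π i γ) = E.πmR Γ ΓH i j (π j γ) := by
  obtain ⟨ιg, -, hιg⟩ := h.embedding
  exact E.πmL_eq_πmR_of_χΓc_eq Γ ΓH (fun k => hιg k γ) i j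

end Finite

end QPFB

end

theorem proposition9_general {I : Type*} [Finite I] {B H P : Type*} [Ring B] [Algebra ℂ B]
    [Ring H] [HopfAlgebra ℂ H] [Ring P] [Algebra ℂ P]
    (J : I → Ideal B) [∀ i, (J i).IsTwoSided] (hJ : ∀ i, J i ≠ ⊥) (E : QPFB B H P J)
    (Γ : ∀ i, Calculus (B ⧸ J i)) (ΓH : Calculus H) :
    E.IsEmbeddable Γ ΓH (E.Γm Γ ΓH) (E.ofΓm Γ ΓH) (E.πm Γ ΓH) ∧
    ∀ (Γg : DiffAlg) (of : B →ₐ[ℂ] Γg) (π : ∀ i, DiffAlg.Hom Γg (Γ i).toDiffAlg),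
      E.IsEmbeddable Γ ΓH Γg of π →
      ∃ f : DiffAlg.Hom Γg (E.Γm Γ ΓH), Function.Injective f ∧
        (∀ b, f (of b) = E.ofΓm Γ ΓH b) ∧
        ∀ i γ, E.πm Γ ΓH i (f γ) = π i γ := by
  refine ⟨E.isEmbeddable_Γm Γ ΓH hJ, fun Γg of π h => ?_⟩
  exact ⟨DiffAlg.gluingLift π h.πmL_eq_πmR, DiffAlg.gluingLift_injective _ h.isLC.covering,
    fun b => DiffAlg.gluing_ext (h.π_of · b), DiffAlg.gluingProj_gluingLift π h.πmL_eq_πmR⟩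

theorem proposition9 {I : Type*} [Finite I] {B H P : Type*} [Ring B] [Algebra ℂ B]
    [Ring H] [HopfAlgebra ℂ H] [Ring P] [Algebra ℂ P]
    (J : I → Ideal B) [∀ i, (J i).IsTwoSided] (hJ : ∀ i, J i ≠ ⊥) (E : QPFB B H P J)
    (Γ : ∀ i, Calculus (B ⧸ J i)) (ΓH : Calculus H) (hΓH : ΓH.IsRightCovariant) :
    E.IsEmbeddable Γ ΓH (E.Γm Γ ΓH) (E.ofΓm Γ ΓH) (E.πm Γ ΓH) ∧
    ∀ (Γg : DiffAlg) (of : B →ₐ[ℂ] Γg) (π : ∀ i, DiffAlg.Hom Γg (Γ i).toDiffAlg),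
      E.IsEmbeddable Γ ΓH Γg of π →
      ∃ f : DiffAlg.Hom Γg (E.Γm Γ ΓH), Function.Injective f ∧
        (∀ b, f (of b) = E.ofΓm Γ ΓH b) ∧
        ∀ i γ, E.πm Γ ΓH i (f γ) = π i γ :=
  proposition9_general J hJ E Γ ΓH
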